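/- Let $p\neq 2$ be a prime and let $\mathbb F_q$ be a finite field with $q=p^d$ elements, $q\neq 3,5$. Let $(\mathbb T,\mathfrak m)$ be a finite-dimensional commutative local $\mathbb F_q$-algebra with the discrete topology, with residue field $\mathbb T/\mathfrak m\simeq\mathbb F_q$ and with $\mathfrak m^2=0$, and put $m:=\dim_{\mathbb F_q}\mathfrak m$. Let $G_{\mathbb Q}=\mathrm{Gal}(\overline{\mathbb Q}/\mathbb Q)$, let $\rho:G_{\mathbb Q}\to\mathrm{GL}_2(\mathbb T)$ be a continuous representation, let $\overline\rho:G_{\mathbb Q}\to \mathrm{GL}_2(\mathbb F_q)$ be its reduction modulo $\mathfrak m$, and let $D:=\mathrm{Im}(\det\circ\overline\rho)\subseteq\mathbb F_q^\times$. For an $\mathbb F_q$-algebra $X$ write $\mathrm{GL}_2^D(X)$ for the group of $g\in\mathrm{GL}_2(X)$ whose determinant lies in the image of $D$ in $X^\times$, and write $\mathrm M_2^0(\mathbb F_q)$ for the additive group of $2\times2$ matrices of trace $0$, on which $\mathrm{GL}_2(\mathbb F_q)$ acts by conjugation. Assume that (a) $\mathrm{Im}(\overline\rho)=\mathrm{GL}_2^D(\mathbb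 F_q)$; (b) $\mathrm{Im}(\rho)\subseteq\mathrm{GL}_2^D(\mathbb T)$; (c) $\mathbb T$ is generated as an $\mathbb F_q$-algebra by the traces $\mathrm{tr}\,\rho(\sigma)$, $\sigma\in G_{\mathbb Q}$; and let $N$ be an integer $\ge 1$ such that $\rho$ is unramified at every prime $\ell\nmid pN$. Then there exist number fields $L/K/\mathbb Q$ inside $\overline{\mathbb Q}$, Galois over $\mathbb Q$, with $G_K=\ker\overline\rho$ and $G_L=\ker\rho$, such that $\overline\rho$ induces an isomorphism $\mathrm{Gal}(K/\mathbb Q)\simeq\mathrm{GL}_2^D(\mathbb F_q)$ and $$\mathrm{Gal}(L/\mathbb Q)\simeq\underbrace{\big(\mathrm M_2^0(\mathbb F_q)\oplus\cdots\oplus\mathrm M_2^0(\mathbb F_q)\big)}_{m}\rtimes\mathrm{Gal}(K/\mathbb Q),$$ where $\mathrm{Gal}(K/\mathbb Q)\simeq\mathrm{GL}_2^D(\mathbb F_q)$ acts by conjugation on each summand and the projection to $\mathrm{Gal}(K/\mathbb Q)$ is the restriction map; thus $\mathrm M_2^0(\mathbb F_q)^m$ corresponds to $\mathrm{Gal}(L/K)$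 with the conjugation action of $\mathrm{Gal}(K/\mathbb Q)$. Moreover, $L/K$ is an abelian Galois extension of degree $p^{3dm}$; it is unramified at all primes of $K$ above every prime number $\ell\nmid pN$; and, if $m\ge 1$, it cannot be defined over $\mathbb Q$, i.e. there is no Galois extension $E/\mathbb Q$ with $L=KE$ and $K\cap E=\mathbb Q$. -/

import Mathlib

open scoped NumberField

noncomputable section

/-- The field of algebraic numbers, as a fixed algebraic closure of `ℚ`. -/
abbrev QBar : Type := AlgebraicClosure ℚ

/-- The absolute Galois group of `ℚ`; it carries the Krull topology. -/
abbrev GQ : Type := Gal(QBar/ℚ)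

/-- For a commutative algebra `X` over a field `k` and a subgroup `D` of `kˣ`, the group
`GL₂^D(X)` of invertible `2 × 2` matrices over `X` whose determinant lies in the image of `D`. -/
def GL2D {k : Type*} [Field k] (D : Subgroup kˣ) (X : Type*) [CommRing X] [Algebra k X] :
    Subgroup (GL (Fin 2) X) :=
  (D.map (Units.map (algebraMap k X : k →* X))).comap Matrix.GeneralLinearGroup.det

/-- The additive group `M₂⁰(k)` of `2 × 2` matrices of trace zero. -/
def traceZero (k : Type*) [Field k] : AddSubgroup (Matrix (Fin 2) (Fin 2) k) :=
  (Matrix.traceAddMonoidHom (Fin 2) k).ker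

theorem conj_mem_traceZero {k : Type*} [Field k] (g : GL (Fin 2) k)
    {A : Matrix (Fin 2) (Fin 2) k} (hA : A ∈ traceZero k) :
    (g : Matrix (Fin 2) (Fin 2) k) * A * ((g⁻¹ : GL (Fin 2) k) : Matrix (Fin 2) (Fin 2) k)
      ∈ traceZero k := by
  have h : A.trace = 0 := hA
  change (_ : Matrix (Fin 2) (Fin 2) k).trace = 0
  rw [Matrix.trace_mul_comm, ← mul_assoc, ← Units.val_mul, inv_mul_cancel, Units.val_one, one_mul, h]

/-- The conjugation action of `GL₂(k)` on `M₂⁰(k)`: `g • A = g A g⁻¹`. -/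
instance traceZeroConj (k : Type*) [Field k] :
    DistribMulAction (GL (Fin 2) k) (traceZero k) where
  smul g A := ⟨_, conj_mem_traceZero g A.2⟩
  one_smul A := Subtype.ext <| by
    change ((1 : GL (Fin 2) k) : Matrix (Fin 2) (Fin 2) k) * A.1 * _ = A.1
    simp
  mul_smul g h A := Subtype.ext <| by
    change ((g * h : GL (Fin 2) k) : Matrix (Fin 2) (Fin 2) k) * A.1 *
        (((g * h)⁻¹ : GL (Fin 2) k) : Matrix (Fin 2) (Fin 2) k)
      = (g : Matrix (Fin 2) (Fin 2) k) * ((h : Matrix (Fin 2) (Fin 2) k) * A.1 *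
        ((h⁻¹ : GL (Fin 2) k) : Matrix (Fin 2) (Fin 2) k)) *
        ((g⁻¹ : GL (Fin 2) k) : Matrix (Fin 2) (Fin 2) k)
    rw [mul_inv_rev, Units.val_mul, Units.val_mul]
    simp only [mul_assoc]
  smul_zero g := Subtype.ext <| by
    change (g : Matrix (Fin 2) (Fin 2) k) * 0 * _ = 0
    simp
  smul_add g A B := Subtype.ext <| by
    change (g : Matrix (Fin 2) (Fin 2) k) * (A.1 + B.1) * _ = _ * A.1 * _ + _ * B.1 * _
    rw [mul_add, add_mul]

/-- The diagonal conjugation action of `GL₂(k)` on `M₂⁰(k)^m` (written multiplicatively). -/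
def conjAction (k : Type*) [Field k] (m : ℕ) :
    GL (Fin 2) k →* MulAut (Multiplicative (Fin m → traceZero k)) where
  toFun g := (DistribMulAction.toAddEquiv (Fin m → traceZero k) g).toMultiplicative
  map_one' := by
    ext x : 1
    exact congrArg Multiplicative.ofAdd (one_smul (GL (Fin 2) k) x.toAdd)
  map_mul' g h := by
    ext x : 1
    exact congrArg Multiplicative.ofAdd (mul_smul g h x.toAdd)

/-- The reduction `ρ̄ : Γ → GL₂(k)` modulo the maximal ideal of a representation
`ρ : Γ → GL₂(𝕋)`, where the residue field of `𝕋` is identified with `k`. -/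
def residualRep {k 𝕋 Γ : Type*} [Field k] [CommRing 𝕋] [IsLocalRing 𝕋] [Algebra k 𝕋] [Group Γ]
    (e : IsLocalRing.ResidueField 𝕋 ≃ₐ[k] k) (ρ : Γ →* GL (Fin 2) 𝕋) : Γ →* GL (Fin 2) k :=
  (Matrix.GeneralLinearGroup.map
    ((e : IsLocalRing.ResidueField 𝕋 →+* k).comp (IsLocalRing.residue 𝕋))).comp ρ

/-- A homomorphism on the absolute Galois group of `ℚ` is unramified at `ℓ` if it is trivial
on the inertia group of every prime ideal above `ℓ` of the ring of all algebraic integers.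
(`𝔩.inertia GQ` is the group of all `σ` with `σ x ≡ x` modulo `𝔩` for all algebraic integers.) -/
def IsUnramifiedRepAt {G : Type*} [Group G] (ρ : GQ →* G) (ℓ : ℕ) : Prop :=
  ∀ 𝔩 : Ideal (𝓞 QBar), 𝔩.IsPrime → (ℓ : 𝓞 QBar) ∈ 𝔩 → 𝔩.inertia GQ ≤ ρ.ker

/-- The extension `L/K` is unramified at (all primes above) the rational prime `ℓ`. -/
def IsUnramifiedExtAt (K L : Type*) [Field K] [Field L] [Algebra K L] (ℓ : ℕ) : Prop :=
  ∀ (P : Ideal (𝓞 L)) [P.IsPrime], (ℓ : 𝓞 L) ∈ P → Algebra.IsUnramifiedAt (𝓞 K) P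

/-- For subfields `K ≤ L` of `QBar` with `L/K` Galois, the extension `L/K` is defined over `ℚ` if it
is the base change to `K` of a Galois extension `E/ℚ`, i.e. `L = KE` and `K ∩ E = ℚ`
(so that restriction to `E` identifies `Gal(L/K)` with `Gal(E/ℚ)`). -/
def IsDefinedOverRat (K L : IntermediateField ℚ QBar) : Prop :=
  ∃ E : IntermediateField ℚ QBar, IsGalois ℚ E ∧ K ⊔ E = L ∧ K ⊓ E = ⊥

end

/-! Since `𝔪² = 0`, `𝕋 = k ⊕ 𝔪` is a square-zero extension, and everything rests on the image of `ρ`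
being all of `GL₂^D(𝕋)` (`eq_GL2D_of_adjoin_trace`).

Let `G` be the image. The matrices `N` over `𝔪` with `1 + N ∈ G` form an additive group of
trace-zero matrices, stable under conjugation by the residual image, which contains `SL₂(k)`. As `2`
is invertible, this group is `M₂⁰(W)` for a `k`-subspace `W ⊆ 𝔪`, the `unipotentSpace`. If `W ≠ 𝔪`,
some nonzero linear form `ψ` on `𝕋` kills `W` and `1`; by `𝔪² = 0` it is a derivation into `k`. Then
`g ↦ ψ(g) ḡ⁻¹` is a crossed homomorphism with values in `M₂⁰(k)`, because determinants in `G` are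
scalars, and it factors through the residual image, because `ψ` kills `W`. The first cohomology of
the residual image in `M₂⁰(k)` vanishes (`IsConjCocycle.exists_eq_coboundary`, where `q ≠ 3, 5` is
needed), so `ψ(g) = ḡY - Yḡ` has trace zero. Thus `ψ` kills every trace, hence all of `𝕋`: a
contradiction.

Coordinates on `𝔪` now give `m` such derivations. Their cocycles together with restriction to `K`
identify `Gal(L/ℚ)` with the semidirect product, split by the constant matrices `GL₂^D(k)`. Were
`L/K` defined over `ℚ`, `G_K` would be central modulo `G_L`, yet `1 + v e₁₂` with `0 ≠ v ∈ 𝔪` does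
not commute with `1 + e₂₁`. Ramification is controlled by lifting inertia from `L` to `ℚ̄`. -/

noncomputable section

/-! ### Vanishing of `H¹(Γ, M₂⁰(k))` for `Γ ⊇ SL₂(k)`. -/

section Cocycle

variable {k : Type*} [Field k]

/-- The upper unipotent matrix with off-diagonal entry `x`. -/
def upperUnip {R : Type*} [CommRing R] (x : R) : GL (Fin 2) R :=
  ⟨!![1, x; 0, 1], !![1, -x; 0, 1], by simp [Matrix.one_fin_two], by simp [Matrix.one_fin_two]⟩

/-- The lower unipotent matrix with off-diagonal entry `x`. -/
def lowerUnip {R : Type*} [CommRing R] (x : R) : GL (Fin 2) R :=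
  ⟨!![1, 0; x, 1], !![1, 0; -x, 1], by simp [Matrix.one_fin_two], by simp [Matrix.one_fin_two]⟩

/-- The diagonal matrix with entries `a` and `a⁻¹`. -/
def diagTorus : kˣ →* GL (Fin 2) k where
  toFun a := ⟨!![(a : k), 0; 0, (a⁻¹ : kˣ)], !![((a⁻¹ : kˣ) : k), 0; 0, a],
    by simp [Matrix.one_fin_two], by simp [Matrix.one_fin_two]⟩
  map_one' := by ext : 1; simp [Matrix.one_fin_two]
  map_mul' a b := by ext : 1; simp [mul_comm]

/-- The Weyl element. -/
def weylElt (k : Type*) [Field k] : GL (Fin 2) k :=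
  ⟨!![0, 1; -1, 0], !![0, -1; 1, 0], by simp [Matrix.one_fin_two], by simp [Matrix.one_fin_two]⟩

@[simp] lemma coe_upperUnip {R : Type*} [CommRing R] (x : R) :
    (upperUnip x : Matrix (Fin 2) (Fin 2) R) = !![1, x; 0, 1] := rfl

@[simp] lemma coe_upperUnip_inv (x : k) :
    (((upperUnip x)⁻¹ : GL (Fin 2) k) : Matrix (Fin 2) (Fin 2) k) = !![1, -x; 0, 1] := rfl

@[simp] lemma coe_lowerUnip {R : Type*} [CommRing R] (x : R) :
    (lowerUnip x : Matrix (Fin 2) (Fin 2) R) = !![1, 0; x, 1] := rfl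

@[simp] lemma coe_lowerUnip_inv (x : k) :
    (((lowerUnip x)⁻¹ : GL (Fin 2) k) : Matrix (Fin 2) (Fin 2) k) = !![1, 0; -x, 1] := rfl

@[simp] lemma coe_diagTorus (a : kˣ) :
    (diagTorus a : Matrix (Fin 2) (Fin 2) k) = !![(a : k), 0; 0, (a⁻¹ : kˣ)] := rfl

@[simp] lemma coe_diagTorus_inv (a : kˣ) :
    (((diagTorus a)⁻¹ : GL (Fin 2) k) : Matrix (Fin 2) (Fin 2) k)
      = !![((a⁻¹ : kˣ) : k), 0; 0, a] := rfl

@[simp] lemma coe_weylElt :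
    (weylElt k : Matrix (Fin 2) (Fin 2) k) = !![0, 1; -1, 0] := rfl

@[simp] lemma coe_weylElt_inv :
    (((weylElt k)⁻¹ : GL (Fin 2) k) : Matrix (Fin 2) (Fin 2) k) = !![0, -1; 1, 0] := rfl

lemma fin_two_zero : (!![0, 0; 0, 0] : Matrix (Fin 2) (Fin 2) k) = 0 := by
  ext i j; fin_cases i <;> fin_cases j <;> rfl

lemma upperUnip_mul (x y : k) : upperUnip x * upperUnip y = upperUnip (x + y) := by
  ext : 1; simp [add_comm]

lemma diagTorus_mul_upperUnip (a : kˣ) (x : k) :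
    diagTorus a * upperUnip x = upperUnip (a ^ 2 * x) * diagTorus a := by
  ext : 1
  simp only [Units.val_mul, coe_diagTorus, coe_upperUnip, Matrix.mul_fin_two]
  have : (a : k) ≠ 0 := a.ne_zero
  simp; field_simp

lemma weylElt_mul_diagTorus (a : kˣ) :
    weylElt k * diagTorus a = diagTorus a⁻¹ * weylElt k := by
  ext : 1
  rw [Units.val_mul, Units.val_mul, coe_diagTorus, coe_diagTorus]
  simp

lemma weylElt_mul_upperUnip (x : k) :
    weylElt k * upperUnip x = lowerUnip (-x) * weylElt k := by
  ext : 1; simp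

lemma weylElt_eq : weylElt k = upperUnip 1 * lowerUnip (-1) * upperUnip 1 := by
  ext : 1; simp

/-- The set of elements of determinant one is covered by products of unipotents. -/
lemma mem_of_det_eq_one (S : Submonoid (GL (Fin 2) k)) (hu : ∀ x, upperUnip x ∈ S)
    (hl : ∀ x, lowerUnip x ∈ S) (g : GL (Fin 2) k)
    (hg : (g : Matrix (Fin 2) (Fin 2) k).det = 1) : g ∈ S := by
  have key : ∀ g : GL (Fin 2) k, (g : Matrix (Fin 2) (Fin 2) k).det = 1 →
      (g : Matrix (Fin 2) (Fin 2) k) 1 0 ≠ 0 → g ∈ S := by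
    intro g hg h
    obtain ⟨A, hA⟩ : ∃ A : Matrix (Fin 2) (Fin 2) k, A = g := ⟨_, rfl⟩
    rw [← hA] at hg h
    have : g = upperUnip ((A 0 0 - 1) / A 1 0) * lowerUnip (A 1 0)
        * upperUnip ((A 1 1 - 1) / A 1 0) := by
      ext : 1
      rw [← hA]
      rw [Matrix.det_fin_two] at hg
      conv_lhs => rw [Matrix.eta_fin_two A]
      simp only [Units.val_mul, coe_lowerUnip, coe_upperUnip, Matrix.mul_fin_two]
      congr 1
      ext i j
      fin_cases i <;> fin_cases j <;> simp <;> field_simp <;>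
        first | ring1 | linear_combination hg | linear_combination -hg
    rw [this]
    exact mul_mem (mul_mem (hu _) (hl _)) (hu _)
  by_cases h : (g : Matrix (Fin 2) (Fin 2) k) 1 0 = 0
  -- The new lower left entry is the upper left entry of `g`, nonzero because `g` is triangular of
  -- determinant one.
  · have h1 : lowerUnip 1 * g ∈ S := by
      apply key
      · rw [Units.val_mul, Matrix.det_mul, hg]; simp [Matrix.det_fin_two]
      · rw [Units.val_mul, Matrix.mul_apply, Fin.sum_univ_two]
        simp only [coe_lowerUnip, h]
        rw [Matrix.det_fin_two, h] at hg
        intro h0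
        simp at h0
        simp [h0] at hg
    have h2 : g = lowerUnip (-1) * (lowerUnip 1 * g) := by
      rw [← mul_assoc]
      have : lowerUnip (-1) * lowerUnip (1 : k) = 1 := by ext : 1; simp [Matrix.one_fin_two]
      rw [this, one_mul]
    rw [h2]
    exact mul_mem (hl _) h1
  · exact key g hg h

/-- A crossed homomorphism on the subgroup `Γ` for the conjugation action on matrices. -/
def IsConjCocycle (Γ : Subgroup (GL (Fin 2) k)) (c : GL (Fin 2) k → Matrix (Fin 2) (Fin 2) k) :
    Prop :=
  ∀ g ∈ Γ, ∀ h ∈ Γ, c (g * h) =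
    c g + (g : Matrix (Fin 2) (Fin 2) k) * c h * ((g⁻¹ : GL (Fin 2) k) : Matrix (Fin 2) (Fin 2) k)

lemma isConjCocycle_sub_coboundary {Γ : Subgroup (GL (Fin 2) k)}
    {c : GL (Fin 2) k → Matrix (Fin 2) (Fin 2) k}
    (hc : IsConjCocycle Γ c) (Y : Matrix (Fin 2) (Fin 2) k) :
    IsConjCocycle Γ (fun g => c g - ((g : Matrix (Fin 2) (Fin 2) k) * Y *
      ((g⁻¹ : GL (Fin 2) k) : Matrix (Fin 2) (Fin 2) k) - Y)) := by
  intro g hg h hh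
  simp only [hc g hg h hh, mul_inv_rev, Units.val_mul]
  noncomm_ring

lemma trace_sub_coboundary (c : GL (Fin 2) k → Matrix (Fin 2) (Fin 2) k)
    (Y : Matrix (Fin 2) (Fin 2) k) (g : GL (Fin 2) k) :
    (c g - ((g : Matrix (Fin 2) (Fin 2) k) * Y *
      ((g⁻¹ : GL (Fin 2) k) : Matrix (Fin 2) (Fin 2) k) - Y)).trace = (c g).trace := by
  rw [Matrix.trace_sub, Matrix.trace_sub, Matrix.trace_mul_comm, ← mul_assoc, ← Units.val_mul,
    inv_mul_cancel, Units.val_one, one_mul, sub_self, sub_zero]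

/-- A cocycle becomes trivial on the torus after subtracting a coboundary, by averaging. -/
lemma exists_eq_coboundary_diagTorus [Finite k] {Γ : Subgroup (GL (Fin 2) k)}
    {c : GL (Fin 2) k → Matrix (Fin 2) (Fin 2) k} (hc : IsConjCocycle Γ c)
    (hΓ : ∀ g : GL (Fin 2) k, (g : Matrix (Fin 2) (Fin 2) k).det = 1 → g ∈ Γ) :
    ∃ Y, ∀ a : kˣ, c (diagTorus a) = (diagTorus a : Matrix (Fin 2) (Fin 2) k) * Y *
      (((diagTorus a)⁻¹ : GL (Fin 2) k) : Matrix (Fin 2) (Fin 2) k) - Y := by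
  have := Fintype.ofFinite k
  classical
  have hT : ∀ a : kˣ, diagTorus a ∈ Γ := fun a => hΓ _ (by simp [Matrix.det_fin_two])
  -- The average needs no division: the torus has `q - 1` elements, which is `-1` in `k`.
  refine ⟨∑ b : kˣ, c (diagTorus b), fun a => ?_⟩
  have h1 : ∑ b : kˣ, c (diagTorus (a * b)) = ∑ b : kˣ, c (diagTorus b) :=
    Fintype.sum_equiv (Equiv.mulLeft a) _ _ (fun _ => rfl)
  have h2 : (Fintype.card kˣ : k) = -1 := by
    rw [Fintype.card_units, Nat.cast_sub Fintype.card_pos]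
    simp
  have h3 : ∑ b : kˣ, c (diagTorus (a * b)) = (Fintype.card kˣ : k) • c (diagTorus a) +
      (diagTorus a : Matrix (Fin 2) (Fin 2) k) * (∑ b : kˣ, c (diagTorus b)) *
      (((diagTorus a)⁻¹ : GL (Fin 2) k) : Matrix (Fin 2) (Fin 2) k) := by
    simp_rw [map_mul, hc _ (hT a) _ (hT _), Finset.sum_add_distrib, Finset.mul_sum, Finset.sum_mul]
    simp [Nat.cast_smul_eq_nsmul]
  rw [h1, h2] at h3
  rw [neg_one_smul] at h3
  rw [eq_sub_iff_add_eq]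
  nth_rw 1 [h3]
  abel

/-- The polynomial `X⁴ - 1` has at most four roots, so failure forces `q ≤ 5`, and `q` is odd. This
is the only use of `q ≠ 3, 5`. -/
lemma exists_unit_pow_four_ne_one [Finite k] (h2 : (2 : k) ≠ 0) (hq3 : Nat.card k ≠ 3)
    (hq5 : Nat.card k ≠ 5) : ∃ a : kˣ, (a : k) ^ 4 ≠ 1 := by
  have := Fintype.ofFinite k
  classical
  by_contra! h
  have h1 : Fintype.card kˣ ≤ 4 := by
    have := (Polynomial.card_nthRoots 4 (1 : k))
    refine le_trans ?_ this
    have hinj : Function.Injective (Units.val : kˣ → k) := Units.val_injective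
    rw [← Finset.card_univ, ← Finset.card_image_of_injective _ hinj]
    refine le_trans (Finset.card_le_card ?_) (Multiset.toFinset_card_le _)
    intro x hx
    obtain ⟨a, -, rfl⟩ := Finset.mem_image.1 hx
    rw [Multiset.mem_toFinset, Polynomial.mem_nthRoots (by norm_num)]
    exact h a
  have hodd : ¬ 2 ∣ Nat.card k := by
    intro hd
    obtain ⟨p, hp⟩ := CharP.exists k
    have hpp : p.Prime := CharP.char_is_prime k p
    obtain ⟨n, hp, hn⟩ := FiniteField.card k p
    rw [Nat.card_eq_fintype_card, hn] at hd
    have := (Nat.prime_dvd_prime_iff_eq Nat.prime_two hp).1 (Nat.prime_two.dvd_of_dvd_pow hd)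
    subst this
    exact h2 (by exact_mod_cast CharP.cast_eq_zero k 2)
  rw [Fintype.card_units] at h1
  rw [Nat.card_eq_fintype_card] at *
  have := Fintype.one_lt_card (α := k)
  omega

/-- A trace zero cocycle that vanishes on the torus is, on the upper unipotents, linear with values
in the upper triangular nilpotent matrices. -/
lemma conjCocycle_upperUnip [Finite k] (h2 : (2 : k) ≠ 0) (hq3 : Nat.card k ≠ 3)
    (hq5 : Nat.card k ≠ 5) {Γ : Subgroup (GL (Fin 2) k)}
    {c : GL (Fin 2) k → Matrix (Fin 2) (Fin 2) k} (hc : IsConjCocycle Γ c)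
    (hΓ : ∀ g : GL (Fin 2) k, (g : Matrix (Fin 2) (Fin 2) k).det = 1 → g ∈ Γ)
    (htr : ∀ g ∈ Γ, (c g).trace = 0) (hT : ∀ a, c (diagTorus a) = 0) :
    ∃ β : k, ∀ x, c (upperUnip x) = !![0, x * β; 0, 0] := by
  have hUΓ : ∀ x : k, upperUnip x ∈ Γ := fun a => hΓ _ (by simp [Matrix.det_fin_two])
  have hTΓ : ∀ a : kˣ, diagTorus a ∈ Γ := fun a => hΓ _ (by simp [Matrix.det_fin_two])
  obtain ⟨a, ha⟩ := exists_unit_pow_four_ne_one h2 hq3 hq5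
  have ha0 : (a : k) ≠ 0 := a.ne_zero
  have heta : ∀ x, c (upperUnip x) = !![c (upperUnip x) 0 0, c (upperUnip x) 0 1;
      c (upperUnip x) 1 0, - c (upperUnip x) 0 0] := by
    intro x
    have := htr _ (hUΓ x)
    rw [Matrix.trace_fin_two] at this
    conv_lhs => rw [Matrix.eta_fin_two (c (upperUnip x))]
    rw [eq_neg_of_add_eq_zero_right this]
  set α : k → k := fun x => c (upperUnip x) 0 0
  set β : k → k := fun x => c (upperUnip x) 0 1
  set γ : k → k := fun x => c (upperUnip x) 1 0
  have hadd : ∀ x y, (!![α (x + y), β (x + y); γ (x + y), - α (x + y)] : Matrix _ _ k) =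
      !![α x, β x; γ x, - α x] + !![1, x; 0, 1] * !![α y, β y; γ y, - α y] * !![1, -x; 0, 1] := by
    intro x y
    rw [← heta, ← heta, ← heta, ← upperUnip_mul, hc _ (hUΓ x) _ (hUΓ y)]
    rfl
  have hscale : ∀ (b : kˣ) x, (!![α (b ^ 2 * x), β (b ^ 2 * x);
      γ (b ^ 2 * x), - α (b ^ 2 * x)] : Matrix _ _ k) =
      !![(b : k), 0; 0, (b⁻¹ : kˣ)] * !![α x, β x; γ x, - α x] * !![((b⁻¹ : kˣ) : k), 0; 0, b] := by
    intro b x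
    have := congrArg c (diagTorus_mul_upperUnip b x)
    rw [hc _ (hTΓ b) _ (hUΓ x), hc _ (hUΓ _) _ (hTΓ b), hT, mul_zero, zero_mul, zero_add,
      add_zero] at this
    rw [← heta, ← heta, ← this]
    rfl
  have hγadd : ∀ x y, γ (x + y) = γ x + γ y := fun x y => by
    simpa [Matrix.mul_fin_two] using congrFun (congrFun (hadd x y) 1) 0
  have hαadd : ∀ x y, α (x + y) = α x + α y + x * γ y := fun x y => by
    have := congrFun (congrFun (hadd x y) 0) 0
    simp at this
    linear_combination this
  -- The correction term `x * γ y` in `hαadd` must be symmetric in `x` and `y`.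
  have hγ1 : ∀ x, γ x = x * γ 1 := fun x => by
    have h1 := hαadd x 1
    have h2 := hαadd 1 x
    rw [add_comm 1 x] at h2
    linear_combination h1 - h2
  -- The torus scales `γ` by `a⁻²` while linearity scales it by `a²`, hence `(a⁴ - 1) γ 1 = 0`.
  have hγ0 : ∀ x, γ x = 0 := by
    have h1 := congrFun (congrFun (hscale a 1) 1) 0
    simp at h1
    rw [hγ1 (a ^ 2)] at h1
    have h3 : ((a : k) ^ 4 - 1) * γ 1 = 0 := by
      field_simp at h1
      linear_combination h1
    intro x
    rw [hγ1, (mul_eq_zero.1 h3).resolve_left (sub_ne_zero.2 ha), mul_zero]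
  have hαadd' : ∀ x y, α (x + y) = α x + α y := fun x y => by rw [hαadd, hγ0]; ring
  -- The additive map `α` is invariant under multiplication by `a²`, so it kills `(a² - 1) y` for
  -- every `y`.
  have hα0 : ∀ x, α x = 0 := by
    intro x
    have ha2 : (a : k) ^ 2 - 1 ≠ 0 := fun h => ha (by linear_combination ((a : k) ^ 2 + 1) * h)
    have h1 := congrFun (congrFun (hscale a (x / (a ^ 2 - 1))) 0) 0
    simp [mul_right_comm] at h1
    have h3 : (a : k) ^ 2 * (x / (a ^ 2 - 1)) = x + x / (a ^ 2 - 1) := by field_simp; ring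
    rw [h3, hαadd'] at h1
    linear_combination h1
  have hβadd : ∀ x y, β (x + y) = β x + β y := fun x y => by
    have := congrFun (congrFun (hadd x y) 0) 1
    simp [hα0, hγ0] at this
    linear_combination this
  have hβ0 : β 0 = 0 := by have := hβadd 0 0; simpa using this
  have hβs : ∀ b x : k, β (b ^ 2 * x) = b ^ 2 * β x := by
    intro b x
    rcases eq_or_ne b 0 with rfl | hb
    · simp [hβ0]
    · have := congrFun (congrFun (hscale (Units.mk0 b hb) x) 0) 1
      simp at this
      rw [this]; ring
  refine ⟨β 1, fun x => ?_⟩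
  -- An additive map commuting with multiplication by squares is linear, since `x = ((x + 1) / 2)² -
  -- ((x - 1) / 2)²`.
  have hβ : β x = x * β 1 := by
    have h1 := hβadd x (((x - 1) / 2) ^ 2 * 1)
    have h3 : x + ((x - 1) / 2) ^ 2 * 1 = ((x + 1) / 2) ^ 2 * 1 := by field_simp; ring
    rw [h3, hβs, hβs] at h1
    field_simp at h1
    have h4 : (4 : k) ≠ 0 := by
      have : (4 : k) = 2 * 2 := by norm_num
      rw [this]; exact mul_ne_zero h2 h2
    apply mul_left_cancel₀ h4
    linear_combination -h1
  rw [heta, ← hβ]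
  simp only [β]
  rw [show c (upperUnip x) 0 0 = 0 from hα0 x, show c (upperUnip x) 1 0 = 0 from hγ0 x]
  simp

/-- Vanishing of the first cohomology of `Γ ⊇ SL₂(k)` with coefficients in `M₂⁰(k)`. -/
theorem IsConjCocycle.exists_eq_coboundary [Finite k] (h2 : (2 : k) ≠ 0) (hq3 : Nat.card k ≠ 3)
    (hq5 : Nat.card k ≠ 5) {Γ : Subgroup (GL (Fin 2) k)}
    {c : GL (Fin 2) k → Matrix (Fin 2) (Fin 2) k} (hc : IsConjCocycle Γ c)
    (hΓ : ∀ g : GL (Fin 2) k, (g : Matrix (Fin 2) (Fin 2) k).det = 1 → g ∈ Γ)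
    (htr : ∀ g ∈ Γ, (c g).trace = 0) :
    ∃ Y, ∀ g ∈ Γ, c g = (g : Matrix (Fin 2) (Fin 2) k) * Y *
      ((g⁻¹ : GL (Fin 2) k) : Matrix (Fin 2) (Fin 2) k) - Y := by
  obtain ⟨Y, hY⟩ := exists_eq_coboundary_diagTorus hc hΓ
  obtain ⟨β, hβ⟩ := conjCocycle_upperUnip h2 hq3 hq5 (isConjCocycle_sub_coboundary hc Y) hΓ
    (fun g hg => by rw [trace_sub_coboundary, htr g hg]) (fun a => by rw [hY, sub_self])
  -- The added diagonal matrix commutes with the torus, and its coboundary at `upperUnip x` is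
  -- exactly `x * β` in the upper right corner.
  set Z : Matrix (Fin 2) (Fin 2) k := Y + !![-(β / 2), 0; 0, β / 2] with hZ
  set c' : GL (Fin 2) k → Matrix (Fin 2) (Fin 2) k :=
    fun g => c g - ((g : Matrix (Fin 2) (Fin 2) k) * Z *
      ((g⁻¹ : GL (Fin 2) k) : Matrix (Fin 2) (Fin 2) k) - Z) with hc'
  have hcc : IsConjCocycle Γ c' := isConjCocycle_sub_coboundary hc Z
  have htr' : ∀ g ∈ Γ, (c' g).trace = 0 := fun g hg => by
    rw [hc', trace_sub_coboundary, htr g hg]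
  have hUΓ : ∀ x : k, upperUnip x ∈ Γ := fun a => hΓ _ (by simp [Matrix.det_fin_two])
  have hLΓ : ∀ x : k, lowerUnip x ∈ Γ := fun a => hΓ _ (by simp [Matrix.det_fin_two])
  have hTΓ : ∀ a : kˣ, diagTorus a ∈ Γ := fun a => hΓ _ (by simp [Matrix.det_fin_two])
  have hWΓ : weylElt k ∈ Γ := hΓ _ (by simp [Matrix.det_fin_two])
  have hU : ∀ x, c' (upperUnip x) = 0 := by
    intro x
    have h1 := hβ x
    simp only [hc', hZ]
    rw [sub_eq_iff_eq_add] at h1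
    rw [h1, mul_add, add_mul]
    simp only [coe_upperUnip, coe_upperUnip_inv, Matrix.mul_fin_two]
    rw [sub_eq_zero]
    generalize (!![1, x; 0, 1] * Y * !![1, -x; 0, 1] : Matrix (Fin 2) (Fin 2) k) = M
    have : (!![0, x * β; 0, 0] : Matrix (Fin 2) (Fin 2) k) =
      !![(1 * -(β / 2) + x * 0) * 1 + (1 * 0 + x * (β / 2)) * 0,
        (1 * -(β / 2) + x * 0) * -x + (1 * 0 + x * (β / 2)) * 1;
        (0 * -(β / 2) + 1 * 0) * 1 + (0 * 0 + 1 * (β / 2)) * 0,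
        (0 * -(β / 2) + 1 * 0) * -x + (0 * 0 + 1 * (β / 2)) * 1] - !![-(β / 2), 0; 0, β / 2] := by
      ext i j
      fin_cases i <;> fin_cases j <;> simp
      field_simp; ring
    rw [this]
    abel
  have hTv : ∀ a, c' (diagTorus a) = 0 := by
    intro a
    simp only [hc', hZ, hY a]
    rw [mul_add, add_mul]
    have : (diagTorus a : Matrix (Fin 2) (Fin 2) k) * !![-(β / 2), 0; 0, β / 2] *
      (((diagTorus a)⁻¹ : GL (Fin 2) k) : Matrix (Fin 2) (Fin 2) k)
      = !![-(β / 2), 0; 0, β / 2] := by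
      rw [coe_diagTorus, coe_diagTorus_inv]
      ext i j
      fin_cases i <;> fin_cases j <;> simp [mul_right_comm]
    rw [this]
    abel
  -- The relation with the torus makes `c' (weylElt k)` commute with `diagTorus a`, hence diagonal.
  -- The expression of the Weyl element in unipotents, with `w u(1) = l(-1) w`, then gives twice its
  -- first entry equal to zero.
  have hW : c' (weylElt k) = 0 := by
    obtain ⟨a, ha⟩ := exists_unit_pow_four_ne_one h2 hq3 hq5
    have ha0 : (a : k) ≠ 0 := a.ne_zero
    have ha2 : (a : k) ^ 2 - 1 ≠ 0 := fun h => ha (by linear_combination ((a : k) ^ 2 + 1) * h)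
    have h1 := congrArg c' (weylElt_mul_diagTorus a)
    rw [hcc _ hWΓ _ (hTΓ a), hcc _ (hTΓ _) _ hWΓ, hTv, hTv, mul_zero, zero_mul, zero_add,
      add_zero, Matrix.eta_fin_two (c' (weylElt k)), coe_diagTorus, coe_diagTorus_inv,
      inv_inv] at h1
    have h01 := congrFun (congrFun h1 0) 1
    have h10 := congrFun (congrFun h1 1) 0
    simp at h01 h10
    have e01 : c' (weylElt k) 0 1 = 0 := by
      field_simp at h01
      exact (mul_eq_zero.1 (show ((a : k) ^ 2 - 1) * c' (weylElt k) 0 1 = 0 by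
        linear_combination h01)).resolve_left ha2
    have e10 : c' (weylElt k) 1 0 = 0 := by
      exact (mul_eq_zero.1 (show ((a : k) ^ 2 - 1) * c' (weylElt k) 1 0 = 0 by
        linear_combination -h10)).resolve_left ha2
    have h3 := congrArg c' (weylElt_eq (k := k))
    have h4 := htr' _ hWΓ
    rw [hcc _ (mul_mem (hUΓ _) (hLΓ _)) _ (hUΓ _), hcc _ (hUΓ _) _ (hLΓ _), hU, mul_zero, zero_mul,
      add_zero, zero_add] at h3
    have h5 : c' (lowerUnip (-1)) = (((upperUnip (1 : k))⁻¹ : GL (Fin 2) k) : Matrix (Fin 2) (Fin 2) k) *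
        c' (weylElt k) * (upperUnip (1 : k) : Matrix (Fin 2) (Fin 2) k) := by
      rw [h3]
      simp only [mul_assoc, Units.inv_mul, mul_one]
      rw [← mul_assoc, Units.inv_mul, one_mul]
    have h6 := congrArg c' (weylElt_mul_upperUnip (1 : k))
    rw [hcc _ hWΓ _ (hUΓ _), hcc _ (hLΓ _) _ hWΓ, hU, mul_zero, zero_mul, add_zero, h5] at h6
    rw [Matrix.trace_fin_two] at h4
    rw [Matrix.eta_fin_two (c' (weylElt k)), e01, e10, eq_neg_of_add_eq_zero_right h4, coe_upperUnip,
      coe_upperUnip_inv, coe_lowerUnip, coe_lowerUnip_inv] at h6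
    have h7 := congrFun (congrFun h6 0) 1
    simp at h7
    have e00 : c' (weylElt k) 0 0 = 0 :=
      (mul_eq_zero.1 (show (2 : k) * c' (weylElt k) 0 0 = 0 by linear_combination -h7)).resolve_left h2
    rw [Matrix.eta_fin_two (c' (weylElt k)), e01, e10, eq_neg_of_add_eq_zero_right h4, e00, neg_zero]
    exact fin_two_zero
  have hL : ∀ x, c' (lowerUnip x) = 0 := by
    intro x
    have h6 := congrArg c' (weylElt_mul_upperUnip (-x))
    rw [hcc _ hWΓ _ (hUΓ _), hcc _ (hLΓ _) _ hWΓ, hU, hW, neg_neg, mul_zero, zero_mul, mul_zero,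
      zero_mul, add_zero, add_zero] at h6
    exact h6.symm
  have h1Γ : c' 1 = 0 := by simpa using hTv 1
  let S : Submonoid (GL (Fin 2) k) :=
    { carrier := {g | g ∈ Γ ∧ c' g = 0}
      one_mem' := ⟨one_mem _, h1Γ⟩
      mul_mem' := fun {g h} hg hh => ⟨mul_mem hg.1 hh.1, by
        rw [hcc _ hg.1 _ hh.1, hg.2, hh.2, mul_zero, zero_mul, add_zero]⟩ }
  have hS : ∀ g : GL (Fin 2) k, (g : Matrix (Fin 2) (Fin 2) k).det = 1 → c' g = 0 := fun g hg =>
    (mem_of_det_eq_one S (fun x => ⟨hUΓ x, hU x⟩) (fun x => ⟨hLΓ x, hL x⟩) g hg).2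
  refine ⟨Z, fun g hg => sub_eq_zero.1 (?_ : c' g = 0)⟩
  -- As `SL₂(k)` is normal and `c'` vanishes on it, `c' g` commutes with `SL₂(k)`. It is therefore
  -- scalar, and its trace is zero with `2 ≠ 0`.
  have hinv : ∀ s : GL (Fin 2) k, (s : Matrix (Fin 2) (Fin 2) k).det = 1 →
      c' g * (s : Matrix (Fin 2) (Fin 2) k) = s * c' g := by
    intro s hs
    have hdet : ((g⁻¹ * s * g : GL (Fin 2) k) : Matrix (Fin 2) (Fin 2) k).det = 1 := by
      rw [Units.val_mul, Units.val_mul, Matrix.det_mul, Matrix.det_mul, hs, mul_one,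
        ← Matrix.det_mul, ← Units.val_mul, inv_mul_cancel]
      simp
    have h1 := congrArg c' (show s * g = g * (g⁻¹ * s * g) by group)
    rw [hcc _ (hΓ s hs) _ hg, hcc _ hg _ (hΓ _ hdet), hS _ hs, hS _ hdet, mul_zero, zero_mul,
      zero_add, add_zero] at h1
    conv_lhs => rw [← h1]
    simp only [mul_assoc, Units.inv_mul, mul_one]
  have hu := hinv (upperUnip 1) (by simp [Matrix.det_fin_two])
  have hl := hinv (lowerUnip 1) (by simp [Matrix.det_fin_two])
  have ht := htr' g hg
  generalize c' g = B at hu hl ht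
  rw [Matrix.trace_fin_two] at ht
  rw [Matrix.eta_fin_two B] at hu hl ⊢
  have a1 := congrFun (congrFun hu 0) 0
  have a2 := congrFun (congrFun hu 0) 1
  have a3 := congrFun (congrFun hl 0) 0
  simp at a1 a2 a3
  have e00 : B 0 0 = 0 :=
      (mul_eq_zero.1 (show (2 : k) * B 0 0 = 0 by linear_combination a2 + ht)).resolve_left h2
  have e11 : B 1 1 = 0 := by linear_combination ht - e00
  rw [e00, e11, a1, a3, fin_two_zero]

end Cocycle

/-! ### Derivations of a square-zero extension and their matrix cocycles. -/

section SquareZero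

variable {k T : Type*} [Field k] [CommRing T] [Algebra k T] (π : T →ₐ[k] k)

/-- Entrywise application of a residue map to an invertible matrix. -/
abbrev reduceGL : GL (Fin 2) T →* GL (Fin 2) k :=
  Matrix.GeneralLinearGroup.map (π : T →+* k)

lemma coe_reduceGL (g : GL (Fin 2) T) :
    (reduceGL π g : Matrix (Fin 2) (Fin 2) k) = (g : Matrix (Fin 2) (Fin 2) T).map π := rfl

variable {π}

lemma sub_algebraMap_mem_ker (x : T) : π (x - algebraMap k T (π x)) = 0 := by
  simp

/-- A linear form that kills the scalars of a square-zero extension is a derivation. -/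
lemma leibniz_of_sq_zero (hπ : ∀ x y, π x = 0 → π y = 0 → x * y = 0) (ψ : T →ₗ[k] k)
    (hψ : ψ 1 = 0) (x y : T) : ψ (x * y) = π x * ψ y + ψ x * π y := by
  have h1 := hπ _ _ (sub_algebraMap_mem_ker (π := π) x) (sub_algebraMap_mem_ker (π := π) y)
  have h2 : x * y = π x • y + π y • x - (π x * π y) • (1 : T) := by
    simp only [Algebra.smul_def, map_mul, mul_one]
    linear_combination h1
  rw [h2]
  simp only [map_add, map_sub, map_smul, hψ, smul_eq_mul]
  ring

/-- The cocycle of matrices attached to a derivation `ψ`. -/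
def derivCocycle (π : T →ₐ[k] k) (ψ : T →ₗ[k] k) (g : GL (Fin 2) T) : Matrix (Fin 2) (Fin 2) k :=
  (g : Matrix (Fin 2) (Fin 2) T).map ψ *
    (((reduceGL π g)⁻¹ : GL (Fin 2) k) : Matrix (Fin 2) (Fin 2) k)

lemma map_mul_of_sq_zero (hπ : ∀ x y, π x = 0 → π y = 0 → x * y = 0) (ψ : T →ₗ[k] k)
    (hψ : ψ 1 = 0) (A B : Matrix (Fin 2) (Fin 2) T) :
    (A * B).map ψ = A.map π * B.map ψ + A.map ψ * B.map π := by
  ext i j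
  simp only [Matrix.map_apply, Matrix.mul_apply, Matrix.add_apply, Fin.sum_univ_two, map_add,
    leibniz_of_sq_zero hπ ψ hψ]
  ring

lemma derivCocycle_mul (hπ : ∀ x y, π x = 0 → π y = 0 → x * y = 0) (ψ : T →ₗ[k] k)
    (hψ : ψ 1 = 0) (g h : GL (Fin 2) T) :
    derivCocycle π ψ (g * h) = derivCocycle π ψ g +
      (reduceGL π g : Matrix (Fin 2) (Fin 2) k) * derivCocycle π ψ h *
      (((reduceGL π g)⁻¹ : GL (Fin 2) k) : Matrix (Fin 2) (Fin 2) k) := by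
  simp only [derivCocycle, Units.val_mul, map_mul_of_sq_zero hπ ψ hψ, map_mul, mul_inv_rev,
    ← coe_reduceGL π]
  rw [add_mul, add_comm]
  congr 1
  · rw [mul_assoc, ← mul_assoc ((reduceGL π h : Matrix (Fin 2) (Fin 2) k)), Units.mul_inv, one_mul]
  · simp only [mul_assoc]

/-- By the derivative of the determinant, this trace is `ψ(det g)` divided by the residual
determinant, and `det g` is a scalar. -/
lemma derivCocycle_trace (hπ : ∀ x y, π x = 0 → π y = 0 → x * y = 0) (ψ : T →ₗ[k] k)
    (hψ : ψ 1 = 0) {D : Subgroup kˣ} {g : GL (Fin 2) T} (hg : g ∈ GL2D D T) :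
    (derivCocycle π ψ g).trace = 0 := by
  obtain ⟨d, -, hd⟩ := hg
  have hd' : algebraMap k T d = (g : Matrix (Fin 2) (Fin 2) T).det := congrArg Units.val hd
  have h1 : ψ (g : Matrix (Fin 2) (Fin 2) T).det = 0 := by
    rw [← hd', Algebra.algebraMap_eq_smul_one, map_smul, hψ, smul_zero]
  rw [Matrix.det_fin_two, map_sub, leibniz_of_sq_zero hπ ψ hψ, leibniz_of_sq_zero hπ ψ hψ] at h1
  rw [derivCocycle, Matrix.coe_units_inv, Matrix.inv_def, Matrix.mul_smul, Matrix.trace_smul,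
    Matrix.adjugate_fin_two, coe_reduceGL]
  convert smul_zero _
  rw [Matrix.trace_fin_two]
  simp [Matrix.mul_apply, Fin.sum_univ_two]
  linear_combination h1

lemma derivCocycle_eq_zero_of_map (ψ : T →ₗ[k] k) {g : GL (Fin 2) T}
    (hg : (g : Matrix (Fin 2) (Fin 2) T).map ψ = 0) : derivCocycle π ψ g = 0 := by
  rw [derivCocycle, hg, zero_mul]

lemma reduceGL_mem_GL2D {D : Subgroup kˣ} {g : GL (Fin 2) T} (hg : g ∈ GL2D D T) :
    reduceGL π g ∈ GL2D D k := by
  obtain ⟨d, hd, hd'⟩ := hg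
  refine ⟨d, hd, ?_⟩
  ext
  have := congrArg (fun u : Tˣ => π (u : T)) hd'
  simp only [Units.coe_map, MonoidHom.coe_coe] at this ⊢
  rw [AlgHom.commutes] at this
  rw [this]
  exact (AlgHom.map_det π _).trans rfl

lemma mem_GL2D_of_det_eq_one (D : Subgroup kˣ) {g : GL (Fin 2) T}
    (hg : (g : Matrix (Fin 2) (Fin 2) T).det = 1) : g ∈ GL2D D T := by
  refine ⟨1, one_mem D, ?_⟩
  ext
  simp [hg]

lemma det_eq_one_of_reduceGL {D : Subgroup kˣ} {g : GL (Fin 2) T} (hg : g ∈ GL2D D T)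
    (h1 : reduceGL π g = 1) : (g : Matrix (Fin 2) (Fin 2) T).det = 1 := by
  obtain ⟨d, hd, hd'⟩ := hg
  have hd'' : algebraMap k T d = (g : Matrix (Fin 2) (Fin 2) T).det := congrArg Units.val hd'
  have h2 : π (g : Matrix (Fin 2) (Fin 2) T).det = 1 := by
    rw [AlgHom.map_det]
    change (reduceGL π g : Matrix (Fin 2) (Fin 2) k).det = 1
    rw [h1, Units.val_one, Matrix.det_one]
  rw [← hd'', AlgHom.commutes] at h2
  rw [← hd'', show (d : k) = 1 from h2, map_one]

end SquareZero

/-! ### The image is all of `GL₂^D(T)`. -/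

section FullImage

variable {k T : Type*} [Field k] [CommRing T] [Algebra k T] {π : T →ₐ[k] k}

/-- The additive group of matrices `N` over the kernel of `π` such that `1 + N` belongs to `G`. -/
def congruenceKernel (hπ : ∀ x y, π x = 0 → π y = 0 → x * y = 0) (G : Subgroup (GL (Fin 2) T)) :
    AddSubgroup (Matrix (Fin 2) (Fin 2) T) where
  carrier := {N | (∀ i j, π (N i j) = 0) ∧ ∃ g ∈ G, (g : Matrix (Fin 2) (Fin 2) T) = 1 + N}
  zero_mem' := ⟨fun i j => by simp, 1, one_mem G, by simp⟩
  add_mem' := by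
    rintro A B ⟨hA, g, hg, hgA⟩ ⟨hB, h, hh, hhB⟩
    refine ⟨fun i j => by simp [hA, hB], g * h, mul_mem hg hh, ?_⟩
    have : A * B = 0 := by
      ext i j
      simp [Matrix.mul_apply, hπ _ _ (hA _ _) (hB _ _)]
    rw [Units.val_mul, hgA, hhB, add_mul, mul_add, mul_add, this]
    simp [add_assoc, add_comm]
  neg_mem' := by
    rintro A ⟨hA, g, hg, hgA⟩
    refine ⟨fun i j => by simp [hA], g⁻¹, inv_mem hg, ?_⟩
    have : A * A = 0 := by
      ext i j
      simp [Matrix.mul_apply, hπ _ _ (hA _ _) (hA _ _)]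
    apply Units.inv_eq_of_mul_eq_one_right
    rw [hgA, add_mul, mul_add, mul_add, mul_neg, mul_neg, this]
    simp

lemma mul_eq_of_map_eq (hπ : ∀ x y, π x = 0 → π y = 0 → x * y = 0)
    {A B N : Matrix (Fin 2) (Fin 2) T} (hAB : A.map π = B.map π) (hN : ∀ i j, π (N i j) = 0) :
    A * N = B * N := by
  have h : ∀ i j, π (A i j - B i j) = 0 := fun i j => by
    rw [map_sub, sub_eq_zero]
    exact congrFun (congrFun hAB i) j
  ext i j
  simp only [Matrix.mul_apply, Fin.sum_univ_two]
  linear_combination hπ _ _ (h i 0) (hN 0 j) + hπ _ _ (h i 1) (hN 1 j)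

lemma mul_eq_of_map_eq' (hπ : ∀ x y, π x = 0 → π y = 0 → x * y = 0)
    {A B N : Matrix (Fin 2) (Fin 2) T} (hAB : A.map π = B.map π) (hN : ∀ i j, π (N i j) = 0) :
    N * A = N * B := by
  have h : ∀ i j, π (A i j - B i j) = 0 := fun i j => by
    rw [map_sub, sub_eq_zero]
    exact congrFun (congrFun hAB i) j
  ext i j
  simp only [Matrix.mul_apply, Fin.sum_univ_two]
  linear_combination hπ _ _ (hN i 0) (h 0 j) + hπ _ _ (hN i 1) (h 1 j)

lemma sub_one_apply_mem_ker {n : GL (Fin 2) T} (hn : reduceGL π n = 1) (i j : Fin 2) :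
    π (((n : Matrix (Fin 2) (Fin 2) T) - (1 : Matrix (Fin 2) (Fin 2) T)) i j) = 0 := by
  have := congrArg (fun g : GL (Fin 2) k => (g : Matrix (Fin 2) (Fin 2) k) i j) hn
  simp only [coe_reduceGL, Matrix.map_apply, Units.val_one] at this
  rw [Matrix.sub_apply, map_sub, this]
  fin_cases i <;> fin_cases j <;> simp

/-- The constant lift of `s` need not lie in `G`. It may replace a lift in `G` because products with
matrices over the kernel of `π` only depend on residues. -/
lemma congruenceKernel_conj {hπ : ∀ x y, π x = 0 → π y = 0 → x * y = 0}
    {G : Subgroup (GL (Fin 2) T)} {s : GL (Fin 2) k} (hs : s ∈ G.map (reduceGL π))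
    {N : Matrix (Fin 2) (Fin 2) T} (hN : N ∈ congruenceKernel hπ G) :
    (s : Matrix (Fin 2) (Fin 2) k).map (algebraMap k T) * N *
      ((s⁻¹ : GL (Fin 2) k) : Matrix (Fin 2) (Fin 2) k).map (algebraMap k T)
        ∈ congruenceKernel hπ G := by
  obtain ⟨g, hg, rfl⟩ := hs
  obtain ⟨hN0, n, hn, hnN⟩ := hN
  have hmap : ∀ A : Matrix (Fin 2) (Fin 2) T, ((A.map π).map (algebraMap k T)).map π = A.map π := by
    intro A; ext i j; simp
  have h1 : (reduceGL π g : Matrix (Fin 2) (Fin 2) k).map (algebraMap k T) * N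
      = (g : Matrix (Fin 2) (Fin 2) T) * N := by
    rw [coe_reduceGL]
    exact mul_eq_of_map_eq hπ (hmap _) hN0
  have h0 : ∀ A : Matrix (Fin 2) (Fin 2) T, ∀ i j, π ((A * N) i j) = 0 := by
    intro A i j
    simp [Matrix.mul_apply, hN0]
  have h2 : (g : Matrix (Fin 2) (Fin 2) T) * N *
      (((reduceGL π g)⁻¹ : GL (Fin 2) k) : Matrix (Fin 2) (Fin 2) k).map (algebraMap k T)
      = (g : Matrix (Fin 2) (Fin 2) T) * N * ((g⁻¹ : GL (Fin 2) T) : Matrix (Fin 2) (Fin 2) T) := by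
    rw [← map_inv, coe_reduceGL]
    exact mul_eq_of_map_eq' hπ (hmap _) (h0 _)
  rw [h1, h2]
  refine ⟨fun i j => ?_, g * n * g⁻¹, mul_mem (mul_mem hg hn) (inv_mem hg), ?_⟩
  · rw [Matrix.mul_apply, map_sum]
    simp only [map_mul, h0, zero_mul, Finset.sum_const_zero]
  · rw [Units.val_mul, Units.val_mul, hnN, mul_add, add_mul, mul_one, Units.mul_inv]

/-- Here `det (1 + N) = 1 + tr N`, as products in the kernel of `π` vanish, and this determinant is
a scalar with residue `1`. -/
lemma congruenceKernel_trace {hπ : ∀ x y, π x = 0 → π y = 0 → x * y = 0}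
    {G : Subgroup (GL (Fin 2) T)} {D : Subgroup kˣ} (hG : G ≤ GL2D D T)
    {N : Matrix (Fin 2) (Fin 2) T} (hN : N ∈ congruenceKernel hπ G) : N.trace = 0 := by
  obtain ⟨hN0, n, hn, hnN⟩ := hN
  have h1 : reduceGL π n = 1 := by
    ext i j
    rw [coe_reduceGL, hnN]
    simp [hN0, Matrix.one_apply, apply_ite]
  have h2 := det_eq_one_of_reduceGL (hG hn) h1
  rw [hnN, Matrix.det_fin_two] at h2
  simp at h2
  rw [Matrix.trace_fin_two]
  linear_combination h2 - hπ _ _ (hN0 0 0) (hN0 1 1) + hπ _ _ (hN0 0 1) (hN0 1 0)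

/-! ### The congruence kernel as trace-zero matrices over a subspace. -/

section Unipotent

variable {hπ : ∀ x y, π x = 0 → π y = 0 → x * y = 0} {G : Subgroup (GL (Fin 2) T)}

lemma congruenceKernel_conj_upper (hΓ : ∀ g : GL (Fin 2) k,
      (g : Matrix (Fin 2) (Fin 2) k).det = 1 → g ∈ G.map (reduceGL π)) (x : k) {a b c d : T}
    (h : !![a, b; c, d] ∈ congruenceKernel hπ G) :
    !![a + algebraMap k T x * c, b + algebraMap k T x * (d - a) - algebraMap k T x ^ 2 * c;
      c, d - algebraMap k T x * c] ∈ congruenceKernel hπ G := by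
  have := congruenceKernel_conj (hΓ (upperUnip x) (by simp [Matrix.det_fin_two])) h
  rw [coe_upperUnip, coe_upperUnip_inv] at this
  convert this using 1
  ext i j
  fin_cases i <;> fin_cases j <;> simp [Matrix.mul_apply, Fin.sum_univ_two] <;> ring

lemma congruenceKernel_conj_weyl (hΓ : ∀ g : GL (Fin 2) k,
      (g : Matrix (Fin 2) (Fin 2) k).det = 1 → g ∈ G.map (reduceGL π)) {a b c d : T}
    (h : !![a, b; c, d] ∈ congruenceKernel hπ G) :
    !![d, -c; -b, a] ∈ congruenceKernel hπ G := by
  have := congruenceKernel_conj (hΓ (weylElt k) (by simp [Matrix.det_fin_two])) h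
  rw [coe_weylElt, coe_weylElt_inv] at this
  convert this using 1
  ext i j
  fin_cases i <;> fin_cases j <;> simp [Matrix.mul_apply, Fin.sum_univ_two]

variable (hπ G) in
/-- The space of all `v` in the kernel of `π` such that `G` contains the unipotent matrices
with upper right entry in `k v`. -/
def unipotentSpace : Submodule k T where
  carrier := {v | π v = 0 ∧ ∀ z : k, !![0, algebraMap k T z * v; 0, 0] ∈ congruenceKernel hπ G}
  zero_mem' := ⟨map_zero _, fun z => by
    convert zero_mem (congruenceKernel hπ G)
    ext i j; fin_cases i <;> fin_cases j <;> simp⟩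
  add_mem' := fun {v w} hv hw => ⟨by rw [map_add, hv.1, hw.1, add_zero], fun z => by
    convert add_mem (hv.2 z) (hw.2 z) using 1
    ext i j; fin_cases i <;> fin_cases j <;> simp [mul_add]⟩
  smul_mem' := fun x v hv => ⟨by rw [map_smul, hv.1, smul_zero], fun z => by
    convert hv.2 (z * x) using 1
    ext i j; fin_cases i <;> fin_cases j <;> simp [Algebra.smul_def, mul_assoc]⟩

lemma lower_mem_of_mem_unipotentSpace (hΓ : ∀ g : GL (Fin 2) k,
      (g : Matrix (Fin 2) (Fin 2) k).det = 1 → g ∈ G.map (reduceGL π)) {v : T}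
    (hv : v ∈ unipotentSpace hπ G) : !![0, 0; v, 0] ∈ congruenceKernel hπ G := by
  have := congruenceKernel_conj_weyl hΓ (hv.2 (-1))
  simpa using this

lemma upper_mem_of_mem_unipotentSpace {v : T}
    (hv : v ∈ unipotentSpace hπ G) : !![0, v; 0, 0] ∈ congruenceKernel hπ G := by
  have := hv.2 1
  simpa using this

lemma mem_congruenceKernel_of_mem_unipotentSpace (hΓ : ∀ g : GL (Fin 2) k,
      (g : Matrix (Fin 2) (Fin 2) k).det = 1 → g ∈ G.map (reduceGL π)) {a b c : T}
    (ha : a ∈ unipotentSpace hπ G) (hb : b ∈ unipotentSpace hπ G)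
    (hc : c ∈ unipotentSpace hπ G) : !![a, b; c, -a] ∈ congruenceKernel hπ G := by
  -- This produces `!![a, -a; a, -a]`; the off-diagonal entries are then corrected.
  have h1 := congruenceKernel_conj_upper hΓ 1 (lower_mem_of_mem_unipotentSpace hΓ ha)
  have h2 := lower_mem_of_mem_unipotentSpace hΓ (sub_mem hc ha)
  have h3 := upper_mem_of_mem_unipotentSpace (add_mem hb ha)
  convert add_mem (add_mem h1 h2) h3 using 1
  ext i j; fin_cases i <;> fin_cases j <;> simp

lemma lowerLeft_mem_unipotentSpace (h2 : (2 : k) ≠ 0) (hΓ : ∀ g : GL (Fin 2) k,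
      (g : Matrix (Fin 2) (Fin 2) k).det = 1 → g ∈ G.map (reduceGL π)) {a b c d : T}
    (h : !![a, b; c, d] ∈ congruenceKernel hπ G) : c ∈ unipotentSpace hπ G := by
  refine ⟨by simpa using h.1 1 0, fun z => ?_⟩
  -- Applying `u(-z/2) - 1` and then `u(1) - 1` leaves only the upper right entry `-2 (-z/2) c = z
  -- c`. The free `z` turns an additive group into a `k`-space.
  have h3 := sub_mem (congruenceKernel_conj_upper hΓ (-z / 2) h) h
  have h4 : !![algebraMap k T (-z / 2) * c, algebraMap k T (-z / 2) * (d - a) -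
      algebraMap k T (-z / 2) ^ 2 * c; 0, - (algebraMap k T (-z / 2) * c)]
      ∈ congruenceKernel hπ G := by
    convert h3 using 1
    ext i j; fin_cases i <;> fin_cases j <;> simp <;> ring
  have h5 := sub_mem (congruenceKernel_conj_upper hΓ 1 h4) h4
  convert h5 using 1
  have h6 : algebraMap k T z = 2 * algebraMap k T (z / 2) := by
    rw [← map_ofNat (algebraMap k T) 2, ← map_mul, mul_div_cancel₀ _ h2]
  ext i j; fin_cases i <;> fin_cases j <;> simp [h6, neg_div]
  ring

/-- The Weyl element exchanges the two corners up to sign. -/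
lemma upperRight_mem_unipotentSpace (h2 : (2 : k) ≠ 0) (hΓ : ∀ g : GL (Fin 2) k,
      (g : Matrix (Fin 2) (Fin 2) k).det = 1 → g ∈ G.map (reduceGL π)) {a b c d : T}
    (h : !![a, b; c, d] ∈ congruenceKernel hπ G) : b ∈ unipotentSpace hπ G := by
  have := lowerLeft_mem_unipotentSpace h2 hΓ (congruenceKernel_conj_weyl hΓ h)
  simpa using neg_mem this

lemma upperLeft_mem_unipotentSpace (h2 : (2 : k) ≠ 0) (hΓ : ∀ g : GL (Fin 2) k,
      (g : Matrix (Fin 2) (Fin 2) k).det = 1 → g ∈ G.map (reduceGL π)) {a b c : T}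
    (h : !![a, b; c, -a] ∈ congruenceKernel hπ G) : a ∈ unipotentSpace hπ G := by
  have hc := lower_mem_of_mem_unipotentSpace hΓ (lowerLeft_mem_unipotentSpace h2 hΓ h)
  have hb := upper_mem_of_mem_unipotentSpace (upperRight_mem_unipotentSpace h2 hΓ h)
  have h3 : !![a, 0; 0, -a] ∈ congruenceKernel hπ G := by
    convert sub_mem (sub_mem h hb) hc using 1
    ext i j; fin_cases i <;> fin_cases j <;> simp
  -- Conjugating `diag(a, -a)` by `u(-1/2)` puts `a` in the upper right corner.
  have h4 := upperRight_mem_unipotentSpace h2 hΓ (congruenceKernel_conj_upper hΓ (-1 / 2) h3)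
  convert h4 using 1
  have h6 : (1 : T) = 2 * algebraMap k T (1 / 2) := by
    rw [← map_ofNat (algebraMap k T) 2, ← map_mul, mul_div_cancel₀ _ h2, map_one]
  have h7 : algebraMap k T (-1 / 2) = - algebraMap k T (1 / 2) := by
    rw [← map_neg, neg_div]
  rw [h7]
  linear_combination a * h6

lemma entries_mem_unipotentSpace (h2 : (2 : k) ≠ 0) (hΓ : ∀ g : GL (Fin 2) k,
      (g : Matrix (Fin 2) (Fin 2) k).det = 1 → g ∈ G.map (reduceGL π)) {D : Subgroup kˣ}
    (hG : G ≤ GL2D D T) {N : Matrix (Fin 2) (Fin 2) T} (hN : N ∈ congruenceKernel hπ G)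
    (i j : Fin 2) : N i j ∈ unipotentSpace hπ G := by
  have htr := congruenceKernel_trace hG hN
  rw [Matrix.trace_fin_two, ← eq_neg_iff_add_eq_zero, eq_comm, neg_eq_iff_eq_neg] at htr
  rw [Matrix.eta_fin_two N, htr] at hN
  have ha := upperLeft_mem_unipotentSpace h2 hΓ hN
  fin_cases i <;> fin_cases j
  · exact ha
  · exact upperRight_mem_unipotentSpace h2 hΓ hN
  · exact lowerLeft_mem_unipotentSpace h2 hΓ hN
  · simpa [htr] using ha

end Unipotent

/-- If the traces of `G` generate `T`, the congruence kernel contains all unipotent directions: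
otherwise a derivation of `T` that vanishes on the congruence kernel would give a cocycle of the
residual image, which is a coboundary, so that the derivation would vanish on all traces. -/
theorem mem_unipotentSpace_of_adjoin_trace [Finite k] (h2 : (2 : k) ≠ 0) (hq3 : Nat.card k ≠ 3)
    (hq5 : Nat.card k ≠ 5) (hπ : ∀ x y, π x = 0 → π y = 0 → x * y = 0)
    {G : Subgroup (GL (Fin 2) T)} {D : Subgroup kˣ} (hG : G ≤ GL2D D T)
    (hmap : G.map (reduceGL π) = GL2D D k)
    (htr : Algebra.adjoin k ((fun g : GL (Fin 2) T => (g : Matrix (Fin 2) (Fin 2) T).trace) '' G)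
      = ⊤) {v : T} (hv : π v = 0) : v ∈ unipotentSpace hπ G := by
  have hΓ : ∀ g : GL (Fin 2) k, (g : Matrix (Fin 2) (Fin 2) k).det = 1 → g ∈ G.map (reduceGL π) :=
    fun g hg => hmap ▸ mem_GL2D_of_det_eq_one D hg
  by_contra hvW
  -- The scalars are included because `ψ` must kill `1` to be a derivation; applying `π` shows that
  -- they do not help to reach `v`.
  have hlt : unipotentSpace hπ G ⊔ Submodule.span k {(1 : T)} < ⊤ := by
    rw [lt_top_iff_ne_top]
    intro htop
    have : v ∈ unipotentSpace hπ G ⊔ Submodule.span k {(1 : T)} := htop ▸ Submodule.mem_top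
    obtain ⟨w, hw, y, hy, rfl⟩ := Submodule.mem_sup.1 this
    obtain ⟨z, rfl⟩ := Submodule.mem_span_singleton.1 hy
    have hz : z = 0 := by simpa [hw.1] using hv
    rw [hz, zero_smul, add_zero] at hvW
    exact hvW hw
  obtain ⟨ψ, hψ0, hψ⟩ := Submodule.exists_le_ker_of_lt_top _ hlt
  have hψ1 : ψ 1 = 0 := hψ (le_sup_right (a := unipotentSpace hπ G)
    (Submodule.mem_span_singleton_self (1 : T)))
  have hψW : ∀ w ∈ unipotentSpace hπ G, ψ w = 0 := fun w hw =>
    hψ (le_sup_left (b := Submodule.span k {(1 : T)}) hw)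
  have hker : ∀ n ∈ G, reduceGL π n = 1 → derivCocycle π ψ n = 0 := by
    intro n hn hn1
    apply derivCocycle_eq_zero_of_map
    have hN : (n : Matrix (Fin 2) (Fin 2) T) - 1 ∈ congruenceKernel hπ G := by
      exact ⟨sub_one_apply_mem_ker hn1, n, hn, by simp⟩
    ext i j
    have := hψW _ (entries_mem_unipotentSpace h2 hΓ hG hN i j)
    rw [Matrix.sub_apply, map_sub, sub_eq_zero] at this
    rw [Matrix.map_apply, this]
    simp [Matrix.one_apply, apply_ite, hψ1]
  have hdep : ∀ g ∈ G, ∀ h ∈ G, reduceGL π g = reduceGL π h →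
      derivCocycle π ψ g = derivCocycle π ψ h := by
    intro g hg h hh hgh
    have h1 := derivCocycle_mul hπ ψ hψ1 (g * h⁻¹) h
    have h3 : reduceGL π (g * h⁻¹) = 1 := by rw [map_mul, map_inv, hgh, mul_inv_cancel]
    rw [hker _ (mul_mem hg (inv_mem hh)) h3, h3, inv_mul_cancel_right] at h1
    simpa using h1
  choose! lift hlift using fun s (hs : s ∈ G.map (reduceGL π)) => hs
  have hcoc : IsConjCocycle (G.map (reduceGL π)) (fun s => derivCocycle π ψ (lift s)) := by
    intro g hg h hh
    have h1 := derivCocycle_mul hπ ψ hψ1 (lift g) (lift h)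
    rw [(hlift g hg).2] at h1
    rw [← h1]
    apply hdep _ (hlift _ (mul_mem hg hh)).1 _ (mul_mem (hlift g hg).1 (hlift h hh).1)
    rw [(hlift _ (mul_mem hg hh)).2, map_mul, (hlift g hg).2, (hlift h hh).2]
  obtain ⟨Y, hY⟩ := hcoc.exists_eq_coboundary h2 hq3 hq5 hΓ
    (fun g hg => derivCocycle_trace hπ ψ hψ1 (hG (hlift g hg).1))
  -- The coboundary relation multiplied by `ḡ` on the right reads `ψ(g) = ḡY - Yḡ`, a commutator.
  have htrace : ∀ g ∈ G, ψ (g : Matrix (Fin 2) (Fin 2) T).trace = 0 := by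
    intro g hg
    have hs : reduceGL π g ∈ G.map (reduceGL π) := ⟨g, hg, rfl⟩
    have h1 := hY _ hs
    rw [hdep _ (hlift _ hs).1 g hg (hlift _ hs).2, derivCocycle] at h1
    have h3 := congrArg (· * (reduceGL π g : Matrix (Fin 2) (Fin 2) k)) h1
    simp only [sub_mul, mul_assoc, Units.inv_mul, mul_one] at h3
    have h4 := congrArg Matrix.trace h3
    rw [Matrix.trace_sub, Matrix.trace_mul_comm, sub_self] at h4
    rw [Matrix.trace_fin_two] at h4 ⊢
    simpa using h4
  let S : Subalgebra k T :=
    { carrier := {t | ψ t = 0}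
      mul_mem' := fun {a b} (ha : ψ a = 0) (hb : ψ b = 0) => by
        change ψ (a * b) = 0
        rw [leibniz_of_sq_zero hπ ψ hψ1, ha, hb, mul_zero, zero_mul, add_zero]
      add_mem' := fun {a b} (ha : ψ a = 0) (hb : ψ b = 0) => by
        change ψ (a + b) = 0
        rw [map_add, ha, hb, add_zero]
      algebraMap_mem' := fun r => by
        change ψ (algebraMap k T r) = 0
        rw [Algebra.algebraMap_eq_smul_one, map_smul, hψ1, smul_zero] }
  have hS : S = ⊤ := by
    rw [eq_top_iff, ← htr]
    apply Algebra.adjoin_le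
    rintro _ ⟨g, hg, rfl⟩
    exact htrace g hg
  exact hψ0 (LinearMap.ext fun t => (hS ▸ Algebra.mem_top : t ∈ S))

/-- A subgroup of `GL₂^D(T)` with residual image `GL₂^D(k)` whose traces generate `T` is
all of `GL₂^D(T)`. -/
theorem eq_GL2D_of_adjoin_trace [Finite k] (h2 : (2 : k) ≠ 0) (hq3 : Nat.card k ≠ 3)
    (hq5 : Nat.card k ≠ 5) (hπ : ∀ x y, π x = 0 → π y = 0 → x * y = 0)
    {G : Subgroup (GL (Fin 2) T)} {D : Subgroup kˣ} (hG : G ≤ GL2D D T)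
    (hmap : G.map (reduceGL π) = GL2D D k)
    (htr : Algebra.adjoin k ((fun g : GL (Fin 2) T => (g : Matrix (Fin 2) (Fin 2) T).trace) '' G)
      = ⊤) : G = GL2D D T := by
  refine le_antisymm hG fun g hg => ?_
  have hΓ : ∀ g : GL (Fin 2) k, (g : Matrix (Fin 2) (Fin 2) k).det = 1 → g ∈ G.map (reduceGL π) :=
    fun g hg => hmap ▸ mem_GL2D_of_det_eq_one D hg
  obtain ⟨h, hh, hhg⟩ : reduceGL π g ∈ G.map (reduceGL π) := hmap ▸ reduceGL_mem_GL2D hg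
  have h1 : reduceGL π (g * h⁻¹) = 1 := by rw [map_mul, map_inv, hhg, mul_inv_cancel]
  have hdet := det_eq_one_of_reduceGL (mul_mem hg (inv_mem (hG hh))) h1
  suffices g * h⁻¹ ∈ G by simpa using mul_mem this hh
  generalize g * h⁻¹ = n at h1 hdet
  have h0 := sub_one_apply_mem_ker h1
  obtain ⟨N, hN⟩ : ∃ N, N = (n : Matrix (Fin 2) (Fin 2) T) - 1 := ⟨_, rfl⟩
  rw [← hN] at h0
  have hn : (n : Matrix (Fin 2) (Fin 2) T) = 1 + N := by rw [hN]; simp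
  have ht : N 1 1 = - N 0 0 := by
    rw [hn, Matrix.det_fin_two] at hdet
    simp at hdet
    linear_combination hdet - hπ _ _ (h0 0 0) (h0 1 1) + hπ _ _ (h0 0 1) (h0 1 0)
  have hmem : N ∈ congruenceKernel hπ G := by
    rw [Matrix.eta_fin_two N, ht]
    apply mem_congruenceKernel_of_mem_unipotentSpace hΓ <;>
      exact mem_unipotentSpace_of_adjoin_trace h2 hq3 hq5 hπ hG hmap htr (h0 _ _)
  obtain ⟨-, g', hg', hgN⟩ := hmem
  rwa [show n = g' from Units.ext (hn.trans hgN.symm)]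

end FullImage

/-! ### The semidirect product and its order. -/

section SemidirectProduct

variable {k T : Type*} [Field k] [CommRing T] [Algebra k T] {π : T →ₐ[k] k}

/-- The homomorphism to the semidirect product given by a family of derivations of `T` and the
reduction of a representation. -/
def toSemidirect (hπ : ∀ x y, π x = 0 → π y = 0 → x * y = 0) {m : ℕ} (ψ : Fin m → T →ₗ[k] k)
    (hψ : ∀ i, ψ i 1 = 0) {Γ Q : Type*} [Group Γ] [Group Q] {D : Subgroup kˣ}
    (ρ : Γ →* GL (Fin 2) T) (hρ : ρ.range ≤ GL2D D T) (r : Γ →* Q) (eK : Q ≃* GL2D D k)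
    (hr : ∀ σ, (eK (r σ) : GL (Fin 2) k) = reduceGL π (ρ σ)) :
    Γ →* Multiplicative (Fin m → traceZero k)
      ⋊[(conjAction k m).comp ((GL2D D k).subtype.comp eK.toMonoidHom)] Q where
  toFun σ := ⟨Multiplicative.ofAdd fun i => ⟨derivCocycle π (ψ i) (ρ σ),
    derivCocycle_trace hπ (ψ i) (hψ i) (hρ ⟨σ, rfl⟩)⟩, r σ⟩
  map_one' := by
    refine SemidirectProduct.ext ?_ (map_one r)
    change Multiplicative.ofAdd _ = Multiplicative.ofAdd _
    congr 1
    ext i : 2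
    change derivCocycle π (ψ i) (ρ 1) = 0
    have := derivCocycle_mul hπ (ψ i) (hψ i) 1 1
    simpa using this
  map_mul' σ τ := by
    refine SemidirectProduct.ext ?_ (map_mul r σ τ)
    change Multiplicative.ofAdd _ = Multiplicative.ofAdd _
    congr 1
    ext i : 2
    change derivCocycle π (ψ i) (ρ (σ * τ)) = derivCocycle π (ψ i) (ρ σ) +
      ((eK (r σ) : GL (Fin 2) k) : Matrix (Fin 2) (Fin 2) k) * derivCocycle π (ψ i) (ρ τ) *
      (((eK (r σ) : GL (Fin 2) k)⁻¹ : GL (Fin 2) k) : Matrix (Fin 2) (Fin 2) k)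
    rw [hr, map_mul, derivCocycle_mul hπ (ψ i) (hψ i)]

variable {hπ : ∀ x y, π x = 0 → π y = 0 → x * y = 0} {m : ℕ} {ψ : Fin m → T →ₗ[k] k}
    {hψ : ∀ i, ψ i 1 = 0} {Γ Q : Type*} [Group Γ] [Group Q] {D : Subgroup kˣ}
    {ρ : Γ →* GL (Fin 2) T} {r : Γ →* Q} {eK : Q ≃* GL2D D k}
    {hr : ∀ σ, (eK (r σ) : GL (Fin 2) k) = reduceGL π (ρ σ)}

lemma toSemidirect_right (hρ : ρ.range ≤ GL2D D T) (σ : Γ) :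
    (toSemidirect hπ ψ hψ ρ hρ r eK hr σ).right = r σ := rfl

lemma ker_toSemidirect (hρ : ρ.range ≤ GL2D D T)
    (hinj : ∀ x, (∀ i, ψ i x = 0) → x = algebraMap k T (π x)) :
    (toSemidirect hπ ψ hψ ρ hρ r eK hr).ker = ρ.ker := by
  ext σ
  simp only [MonoidHom.mem_ker]
  constructor
  · intro h
    have h1 : r σ = 1 := congrArg SemidirectProduct.right h
    have h2 : reduceGL π (ρ σ) = 1 := by rw [← hr, h1, map_one]; rfl
    have h3 : ∀ i, derivCocycle π (ψ i) (ρ σ) = 0 := fun i =>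
      congrArg (fun x => ((Multiplicative.toAdd (SemidirectProduct.left x)) i :
        Matrix (Fin 2) (Fin 2) k)) h
    ext a b
    have h4 : ∀ i, ψ i ((ρ σ : Matrix (Fin 2) (Fin 2) T) a b) = 0 := by
      intro i
      have := h3 i
      rw [derivCocycle, h2, inv_one, Units.val_one, mul_one] at this
      exact congrFun (congrFun this a) b
    rw [hinj _ h4]
    have h5 := congrArg (fun g : GL (Fin 2) k => (g : Matrix (Fin 2) (Fin 2) k) a b) h2
    simp only [coe_reduceGL, Matrix.map_apply, Units.val_one] at h5
    rw [h5]
    fin_cases a <;> fin_cases b <;> simp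
  · intro h
    have h1 : r σ = 1 := by
      apply eK.injective
      ext1
      rw [hr, h, map_one, map_one]
      rfl
    refine SemidirectProduct.ext ?_ h1
    change Multiplicative.ofAdd _ = Multiplicative.ofAdd _
    congr 1
    ext i : 2
    change derivCocycle π (ψ i) (ρ σ) = 0
    rw [h]
    have := derivCocycle_mul hπ (ψ i) (hψ i) 1 1
    simpa using this

lemma map_algebraMap_mem_GL2D {h : GL (Fin 2) k} (hh : h ∈ GL2D D k) :
    Matrix.GeneralLinearGroup.map (algebraMap k T) h ∈ GL2D D T := by
  obtain ⟨d, hd, hd'⟩ := hh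
  refine ⟨d, hd, ?_⟩
  ext
  have h1 : (d : k) = (h : Matrix (Fin 2) (Fin 2) k).det := congrArg Units.val hd'
  simp only [Units.coe_map, MonoidHom.coe_coe]
  rw [h1, RingHom.map_det]
  rfl

lemma toSemidirect_surjective (hρ : ρ.range = GL2D D T)
    (hsurj : ∀ v : Fin m → k, ∃ x, π x = 0 ∧ ∀ i, ψ i x = v i) :
    Function.Surjective (toSemidirect hπ ψ hψ ρ hρ.le r eK hr) := by
  rintro ⟨A, y⟩
  choose f hf0 hf using hsurj
  let B : Fin m → traceZero k := A.toAdd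
  have hB : ∀ i, (B i : Matrix (Fin 2) (Fin 2) k) 1 1 = -(B i : Matrix (Fin 2) (Fin 2) k) 0 0 := by
    intro i
    have : (B i : Matrix (Fin 2) (Fin 2) k).trace = 0 := (B i).2
    rw [Matrix.trace_fin_two] at this
    exact eq_neg_of_add_eq_zero_right this
  obtain ⟨N, hN⟩ : ∃ N : Matrix (Fin 2) (Fin 2) T, N =
      !![f fun i => (B i : Matrix (Fin 2) (Fin 2) k) 0 0,
        f fun i => (B i : Matrix (Fin 2) (Fin 2) k) 0 1;
        f fun i => (B i : Matrix (Fin 2) (Fin 2) k) 1 0,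
        - f fun i => (B i : Matrix (Fin 2) (Fin 2) k) 0 0] := ⟨_, rfl⟩
  have hN0 : ∀ i j, π (N i j) = 0 := by
    intro i j
    rw [hN]
    fin_cases i <;> fin_cases j <;> simp [hf0]
  have hNB : ∀ i a b, ψ i (N a b) = (B i : Matrix (Fin 2) (Fin 2) k) a b := by
    intro i a b
    rw [hN]
    fin_cases a <;> fin_cases b <;> simp [hf, hB]
  have hNN : N * N = 0 := by
    ext i j
    simp [Matrix.mul_apply, hπ _ _ (hN0 _ _) (hN0 _ _)]
  let n : GL (Fin 2) T := ⟨1 + N, 1 - N, by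
    rw [add_mul, mul_sub, mul_sub, hNN]; simp, by rw [sub_mul, mul_add, mul_add, hNN]; simp⟩
  have hn : (n : Matrix (Fin 2) (Fin 2) T) = 1 + N := rfl
  have hdet : (n : Matrix (Fin 2) (Fin 2) T).det = 1 := by
    have h11 : N 1 1 = - N 0 0 := by rw [hN]; simp
    rw [hn, Matrix.det_fin_two]
    simp
    rw [h11]
    linear_combination - hπ _ _ (hN0 0 0) (hN0 0 0) - hπ _ _ (hN0 0 1) (hN0 1 0)
  have hn1 : reduceGL π n = 1 := by
    ext i j
    rw [coe_reduceGL, hn]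
    fin_cases i <;> fin_cases j <;> simp [hN0]
  -- The constant lift has zero cocycle, so `n` alone carries the prescribed coordinates and `h` the
  -- prescribed residue.
  let h : GL (Fin 2) T := Matrix.GeneralLinearGroup.map (algebraMap k T) (eK y : GL (Fin 2) k)
  have hh : reduceGL π h = eK y := by
    ext i j
    rw [coe_reduceGL]
    simp [h]
  obtain ⟨σ, hσ⟩ : n * h ∈ ρ.range := by
    rw [hρ]
    exact mul_mem (mem_GL2D_of_det_eq_one D hdet) (map_algebraMap_mem_GL2D (eK y).2)
  have hred : reduceGL π (ρ σ) = eK y := by rw [hσ, map_mul, hn1, one_mul, hh]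
  refine ⟨σ, SemidirectProduct.ext ?_ ?_⟩
  · change Multiplicative.ofAdd _ = Multiplicative.ofAdd B
    congr 1
    ext i : 2
    change derivCocycle π (ψ i) (ρ σ) = B i
    have hh0 : derivCocycle π (ψ i) h = 0 := by
      apply derivCocycle_eq_zero_of_map
      ext a b
      simp only [h, Matrix.map_apply, Matrix.GeneralLinearGroup.map_apply]
      rw [Algebra.algebraMap_eq_smul_one, map_smul, hψ, smul_zero]
      rfl
    rw [hσ, derivCocycle_mul hπ (ψ i) (hψ i), hh0, mul_zero, zero_mul, add_zero, derivCocycle,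
      hn1, inv_one, Units.val_one, mul_one, hn]
    ext a b
    rw [Matrix.map_apply, Matrix.add_apply, map_add, hNB]
    fin_cases a <;> fin_cases b <;> simp [hψ]
  · apply eK.injective
    ext1
    change ((eK (r σ) : GL2D D k) : GL (Fin 2) k) = _
    rw [hr, hred]

/-- Coordinates on the kernel of `π`, extended by zero on the scalars. -/
lemma exists_derivations (hm : Module.finrank k (LinearMap.ker π.toLinearMap) = m)
    [Module.Finite k T] :
    ∃ ψ : Fin m → T →ₗ[k] k, (∀ i, ψ i 1 = 0) ∧
      (∀ x, (∀ i, ψ i x = 0) → x = algebraMap k T (π x)) ∧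
      (∀ v : Fin m → k, ∃ x, π x = 0 ∧ ∀ i, ψ i x = v i) := by
  let b : Module.Basis (Fin m) k (LinearMap.ker π.toLinearMap) :=
    Module.finBasisOfFinrankEq k _ hm
  let q : T →ₗ[k] LinearMap.ker π.toLinearMap :=
    
    -- The projection onto the kernel of `π` along the scalars.
    (LinearMap.id - (Algebra.linearMap k T).comp π.toLinearMap).codRestrict _ (fun x => by simp)
  have hq : ∀ x, (q x : T) = x - algebraMap k T (π x) := fun x => rfl
  refine ⟨fun i => (b.coord i).comp q, fun i => ?_, fun x hx => ?_, fun v => ?_⟩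
  · have : q 1 = 0 := Subtype.ext (by rw [hq]; simp)
    rw [LinearMap.comp_apply, this, map_zero]
  · have : q x = 0 := b.repr.injective (by ext i; simpa using hx i)
    have h2 := congrArg Subtype.val this
    rw [hq] at h2
    exact sub_eq_zero.1 h2
  · obtain ⟨x, hx⟩ := b.equivFun.surjective v
    refine ⟨x, x.2, fun i => ?_⟩
    have : q x = x := Subtype.ext (by
      rw [hq]
      have : π x = 0 := x.2
      rw [this, map_zero, sub_zero])
    rw [LinearMap.comp_apply, this, Module.Basis.coord_apply, ← hx]
    rfl

lemma card_traceZero (k : Type*) [Field k] : Nat.card (traceZero k) = Nat.card k ^ 3 := by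
  have e : traceZero k ≃ (Fin 3 → k) :=
    { toFun := fun A => ![A.1 0 0, A.1 0 1, A.1 1 0]
      invFun := fun v => ⟨!![v 0, v 1; v 2, -v 0], by
        change Matrix.trace (!![v 0, v 1; v 2, -v 0] : Matrix (Fin 2) (Fin 2) k) = 0
        simp [Matrix.trace_fin_two]⟩
      left_inv := fun A => by
        have : A.1.trace = 0 := A.2
        rw [Matrix.trace_fin_two] at this
        ext i j
        fin_cases i <;> fin_cases j <;> simp
        linear_combination -this
      right_inv := fun v => by
        ext i
        fin_cases i <;> simp }
  rw [Nat.card_congr e, Nat.card_fun, Nat.card_eq_fintype_card (α := Fin 3), Fintype.card_fin]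

end SemidirectProduct

/-! ### Lifting inertia, and unramifiedness from trivial inertia. -/

section Inertia

open scoped Pointwise

/-- Lifting of inertia: an automorphism `s` of `B` that extends an automorphism of `A` acting
trivially modulo the prime below `Q` can be corrected by an element of the profinite group `G` with
ring of invariants `A` so as to act trivially modulo `Q`. -/
theorem exists_smul_sub_mem_of_profinite {A B G : Type*} [CommRing A] [CommRing B] [Algebra A B]
    [Group G] [MulSemiringAction G B] [SMulCommClass G A B] [TopologicalSpace G] [CompactSpace G]
    [TotallyDisconnectedSpace G] [IsTopologicalGroup G] [TopologicalSpace B] [DiscreteTopology B]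
    [ContinuousSMul G B] [Algebra.IsInvariant A B G] (Q : Ideal B) [Q.IsPrime] (s : B ≃+* B)
    (σ : A ≃+* A) (hs : ∀ a, s (algebraMap A B a) = algebraMap A B (σ a))
    (hσ : ∀ a, σ a - a ∈ Q.under A) : ∃ g : G, ∀ b, g • s b - b ∈ Q := by
  have hsσ : ∀ a, s.symm (algebraMap A B a) = algebraMap A B (σ.symm a) := fun a => by
    rw [RingEquiv.symm_apply_eq, hs, RingEquiv.apply_symm_apply]
  have hunder : (Q.comap (s.symm : B →+* B)).under A = Q.under A := by
    ext a
    have h1 := hσ (σ.symm a)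
    rw [RingEquiv.apply_symm_apply] at h1
    change s.symm (algebraMap A B a) ∈ Q ↔ a ∈ Q.under A
    rw [hsσ]
    change σ.symm a ∈ Q.under A ↔ _
    constructor
    · intro h
      simpa using add_mem h1 h
    · intro h
      simpa using sub_mem h h1
  -- The prime `s(Q)` lies over the same prime as `Q`, so transitivity moves it back to `Q`. Then `g
  -- ∘ s` stabilises `Q`, and the automorphism it induces on `B ⧸ Q` comes from the decomposition
  -- group, by which it can be divided.
  obtain ⟨g, hg⟩ := Algebra.IsInvariant.exists_smul_of_under_eq_of_profinite (G := G)
    (Q.comap (s.symm : B →+* B)) Q hunder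
  let t : B ≃+* B := s.trans (MulSemiringAction.toRingEquiv G B g)
  have ht : ∀ b, t b = g • s b := fun b => rfl
  have htQ : ∀ b, t b ∈ Q ↔ b ∈ Q := fun b => by
    conv_lhs => rw [hg]
    rw [ht, Ideal.smul_mem_pointwise_smul_iff]
    change s.symm (s b) ∈ Q ↔ _
    rw [RingEquiv.symm_apply_apply]
  have hmap : Q = Q.map (t : B →+* B) := by
    refine le_antisymm (fun x hx => ?_) (Ideal.map_le_iff_le_comap.2 fun y hy => (htQ y).2 hy)
    rw [← RingEquiv.apply_symm_apply t x, htQ] at hx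
    have := Ideal.mem_map_of_mem (t : B →+* B) hx
    rwa [RingEquiv.coe_toRingHom, RingEquiv.apply_symm_apply] at this
  let φ : (B ⧸ Q) ≃ₐ[A ⧸ Q.under A] B ⧸ Q := AlgEquiv.ofRingEquiv
    (f := Ideal.quotientEquiv Q Q t hmap) (by
      intro x
      obtain ⟨a, rfl⟩ := Ideal.Quotient.mk_surjective x
      change Ideal.Quotient.mk Q (t (algebraMap A B a)) = Ideal.Quotient.mk Q (algebraMap A B a)
      rw [Ideal.Quotient.eq, ht, hs, smul_algebraMap, ← map_sub]
      exact hσ a)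
  obtain ⟨h, hh⟩ := Ideal.Quotient.stabilizerHom_surjective_of_profinite (G := G) (Q.under A) Q φ
  refine ⟨(h : G)⁻¹ * g, fun b => ?_⟩
  have h1 : Ideal.Quotient.mk Q ((h : G) • b) = Ideal.Quotient.mk Q (t b) :=
    congrArg (fun f : (B ⧸ Q) ≃ₐ[A ⧸ Q.under A] B ⧸ Q => f (Ideal.Quotient.mk Q b)) hh
  rw [eq_comm, Ideal.Quotient.eq, ht] at h1
  have h2 := Ideal.smul_mem_pointwise_smul (h : G)⁻¹ _ _ h1
  rw [smul_sub, inv_smul_smul, smul_smul] at h2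
  have h3 : (h : G)⁻¹ • Q = Q := by
    rw [inv_smul_eq_iff]
    exact (MulAction.mem_stabilizer_iff.1 h.2).symm
  rwa [h3] at h2

lemma isFractionRing_ringOfIntegers (F : Type*) [Field F] [Algebra ℚ F]
    [Algebra.IsAlgebraic ℚ F] : IsFractionRing (𝓞 F) F := by
  have : CharZero F := algebraRat.charZero F
  have : Algebra.IsAlgebraic ℤ F := IsFractionRing.comap_isAlgebraic_iff.mpr
    (inferInstance : Algebra.IsAlgebraic ℚ F)
  exact IsIntegralClosure.isFractionRing_of_algebraic ℤ (𝓞 F) (fun x hx => by simpa using hx)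

instance isAlgebraic_QBar : Algebra.IsAlgebraic ℚ QBar := by
  have := AlgebraicClosure.isAlgebraic ℚ
  convert! this

instance isAlgClosure_QBar : IsAlgClosure ℚ QBar where
  isAlgClosed := inferInstance
  isAlgebraic := inferInstance

instance isGalois_QBar : IsGalois ℚ QBar where
  to_normal := IsAlgClosure.normal ℚ QBar
  to_isSeparable := Algebra.IsAlgebraic.isSeparable_of_perfectField

variable (M : Type*) [Field M] [NumberField M] [Algebra M QBar]

theorem exists_mem_inertia_restrictNormalHom [IsGalois ℚ M] (𝔩 : Ideal (𝓞 QBar))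
    [𝔩.IsPrime] {σ : Gal(M/ℚ)} (hσ : σ ∈ (𝔩.under (𝓞 M)).inertia Gal(M/ℚ)) :
    ∃ τ ∈ 𝔩.inertia GQ, AlgEquiv.restrictNormalHom M τ = σ := by
  have : IsGalois M QBar := IsGalois.tower_top_of_isGalois ℚ M QBar
  have : IsFractionRing (𝓞 QBar) QBar := isFractionRing_ringOfIntegers QBar
  have : SMulDistribClass Gal(QBar/M) (𝓞 QBar) QBar := ⟨fun g b x => by
    rw [Algebra.smul_def, smul_mul', Algebra.smul_def]; rfl⟩
  have : IsGaloisGroup Gal(QBar/M) (𝓞 M) (𝓞 QBar) :=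
    IsGaloisGroup.of_isFractionRing Gal(QBar/M) (𝓞 M) (𝓞 QBar) M QBar
  let : TopologicalSpace (𝓞 QBar) := ⊥
  have : DiscreteTopology (𝓞 QBar) := ⟨rfl⟩
  have : ContinuousSMul Gal(QBar/M) (𝓞 QBar) := by
    rw [continuousSMul_iff_stabilizer_isOpen]
    intro x
    convert stabilizer_isOpen_of_isIntegral (K := M) (L := QBar) (x : QBar) using 1
    ext g
    exact Subtype.ext_iff
  obtain ⟨τ, hτ⟩ := AlgEquiv.restrictNormalHom_surjective (F := ℚ) (K₁ := M) QBar σ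
  -- An arbitrary lift `τ` is corrected by an element fixing `M`, which leaves its restriction to
  -- `M` unchanged.
  obtain ⟨g, hg⟩ := exists_smul_sub_mem_of_profinite (A := 𝓞 M) (G := Gal(QBar/M)) 𝔩
    (MulSemiringAction.toRingEquiv GQ (𝓞 QBar) τ) (MulSemiringAction.toRingEquiv Gal(M/ℚ) (𝓞 M) σ)
    (fun a => by
      ext
      change τ (algebraMap M QBar a) = algebraMap M QBar (σ a)
      rw [← hτ]
      exact (AlgEquiv.restrictNormal_commutes τ M a).symm) (fun a => hσ a)
  refine ⟨g.restrictScalars ℚ * τ, fun b => hg b, ?_⟩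
  have h1 : AlgEquiv.restrictNormalHom M (g.restrictScalars ℚ) = 1 := by
    ext x
    apply (algebraMap M QBar).injective
    exact (AlgEquiv.restrictNormal_commutes (g.restrictScalars ℚ) M x).trans (g.commutes x)
  rw [map_mul, h1, one_mul, hτ]

theorem isUnramifiedAt_int_of_inertia_le [IsGalois ℚ M] {ℓ : ℕ}
    (h : ∀ 𝔩 : Ideal (𝓞 QBar), 𝔩.IsPrime → (ℓ : 𝓞 QBar) ∈ 𝔩 →
      𝔩.inertia GQ ≤ (AlgEquiv.restrictNormalHom M : GQ →* Gal(M/ℚ)).ker)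
    (P : Ideal (𝓞 M)) [P.IsPrime] (hP : (ℓ : 𝓞 M) ∈ P) : Algebra.IsUnramifiedAt ℤ P := by
  obtain ⟨𝔩, -, h𝔩, hP𝔩⟩ := Ideal.exists_ideal_over_prime_of_isIntegral (S := 𝓞 QBar) P ⊥ (by
    intro x hx
    have h1 : algebraMap (𝓞 M) (𝓞 QBar) x = 0 := hx
    rw [FaithfulSMul.algebraMap_eq_zero_iff] at h1
    rw [h1]
    exact zero_mem P)
  have hunder : 𝔩.under (𝓞 M) = P := hP𝔩
  have hbot : P.inertia Gal(M/ℚ) = ⊥ := by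
    rw [eq_bot_iff]
    intro σ hσ
    rw [← hunder] at hσ
    obtain ⟨τ, hτ, rfl⟩ := exists_mem_inertia_restrictNormalHom M 𝔩 hσ
    refine h 𝔩 h𝔩 ?_ hτ
    have h1 : algebraMap (𝓞 M) (𝓞 QBar) ℓ ∈ 𝔩 := by
      rw [← Ideal.mem_comap, hP𝔩]
      exact hP
    simpa using h1
  -- The order of inertia is the ramification index, so trivial inertia gives index one.
  have hcard := Ideal.card_inertia_eq_ramificationIdxIn (G := Gal(M/ℚ)) (P.under ℤ) P
  rw [hbot, Subgroup.card_bot,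
    Ideal.ramificationIdxIn_eq_ramificationIdx (P.under ℤ) P Gal(M/ℚ)] at hcard
  exact Ideal.ramificationIdx_eq_one_iff.1 hcard.symm

end Inertia

/-! ### Infinite Galois theory, and extensions defined over `ℚ`. -/

section GaloisTheory

lemma exists_mulEquiv_of_ker_eq {G A B : Type*} [Group G] [Group A] [Group B] (f : G →* A)
    (g : G →* B) (hf : Function.Surjective f) (hg : Function.Surjective g) (h : f.ker = g.ker) :
    ∃ e : A ≃* B, ∀ x, e (f x) = g x := by
  refine ⟨((QuotientGroup.quotientKerEquivOfSurjective f hf).symm.trans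
    (QuotientGroup.quotientMulEquivOfEq h)).trans (QuotientGroup.quotientKerEquivOfSurjective g hg),
    fun x => ?_⟩
  have : (QuotientGroup.quotientKerEquivOfSurjective f hf).symm (f x) = (x : G ⧸ f.ker) := by
    rw [MulEquiv.symm_apply_eq]; rfl
  simp only [MulEquiv.trans_apply, this]
  rfl

lemma isGalois_iff_normal_fixingSubgroup (L : IntermediateField ℚ QBar) :
    IsGalois ℚ L ↔ L.fixingSubgroup.Normal := by
  convert! (InfiniteGalois.normal_iff_isGalois L).symm

lemma ker_restrictNormalHom (L : IntermediateField ℚ QBar) [IsGalois ℚ L] :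
    (AlgEquiv.restrictNormalHom L : GQ →* Gal(L/ℚ)).ker = L.fixingSubgroup := by
  ext σ
  have h : ∀ x : L, ((AlgEquiv.restrictNormalHom L σ x : L) : QBar) = σ x :=
    fun x => AlgEquiv.restrictNormal_commutes σ L x
  rw [MonoidHom.mem_ker, IntermediateField.mem_fixingSubgroup_iff]
  constructor
  · intro h1 x hx
    have := h ⟨x, hx⟩
    rw [h1] at this
    exact this.symm
  · intro h1
    ext x
    exact (h x).trans (h1 x x.2)

/-- The field cut out by a homomorphism on `GQ` with open kernel. -/
lemma fixedField_ker {G : Type*} [Group G] (φ : GQ →* G) (hφ : IsOpen (φ.ker : Set GQ)) :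
    (IntermediateField.fixedField φ.ker).fixingSubgroup = φ.ker ∧
    FiniteDimensional ℚ (IntermediateField.fixedField φ.ker) ∧
    IsGalois ℚ (IntermediateField.fixedField φ.ker) := by
  have h1 : (IntermediateField.fixedField φ.ker).fixingSubgroup = φ.ker :=
    InfiniteGalois.fixingSubgroup_fixedField ⟨φ.ker, Subgroup.isClosed_of_isOpen _ hφ⟩
  refine ⟨h1, ?_, ?_⟩
  · rw [← InfiniteGalois.isOpen_iff_finite, h1]
    exact hφ
  · rw [isGalois_iff_normal_fixingSubgroup, h1]
    infer_instance

/-- Finiteness of `K` makes the join open, hence closed, so it is determined by its fixed field,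
which lies in `K ⊓ E`. -/
lemma fixingSubgroup_sup_eq_top {K E : IntermediateField ℚ QBar} [FiniteDimensional ℚ K]
    (h : K ⊓ E = ⊥) : K.fixingSubgroup ⊔ E.fixingSubgroup = ⊤ := by
  have hopen : IsOpen ((K.fixingSubgroup ⊔ E.fixingSubgroup : Subgroup GQ) : Set GQ) :=
    Subgroup.isOpen_mono le_sup_left K.fixingSubgroup_isOpen
  have h1 := InfiniteGalois.fixingSubgroup_fixedField
    (⟨K.fixingSubgroup ⊔ E.fixingSubgroup, Subgroup.isClosed_of_isOpen _ hopen⟩ : ClosedSubgroup GQ)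
  change (IntermediateField.fixedField (K.fixingSubgroup ⊔ E.fixingSubgroup)).fixingSubgroup =
    K.fixingSubgroup ⊔ E.fixingSubgroup at h1
  have h2 : IntermediateField.fixedField (K.fixingSubgroup ⊔ E.fixingSubgroup) = ⊥ := by
    rw [eq_bot_iff, ← h]
    refine le_inf ?_ ?_
    · conv_rhs => rw [← InfiniteGalois.fixedField_fixingSubgroup K]
      exact IntermediateField.fixedField_antitone le_sup_left
    · conv_rhs => rw [← InfiniteGalois.fixedField_fixingSubgroup E]
      exact IntermediateField.fixedField_antitone le_sup_right
  rw [← h1, h2, IntermediateField.fixingSubgroup_bot]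

/-- An automorphism of `L/K` lifts to an element of the absolute Galois group of `K`. -/
lemma exists_mem_fixingSubgroup_of_algEquiv {K L : IntermediateField ℚ QBar} (hKL : K ≤ L)
    [IsGalois ℚ L] (f : Gal(IntermediateField.extendScalars hKL/K)) :
    ∃ σ ∈ K.fixingSubgroup, ∀ x : IntermediateField.extendScalars hKL, σ (x : QBar) = f x := by
  have : IsGalois K QBar := IsGalois.tower_top_of_isGalois ℚ K QBar
  refine ⟨(f.liftNormal QBar).restrictScalars ℚ, ?_, fun x => f.liftNormal_commutes QBar x⟩
  rw [IntermediateField.mem_fixingSubgroup_iff]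
  intro x hx
  exact (f.liftNormal QBar).commutes ⟨x, hx⟩

/-- Elements that commute modulo `Gal(ℚ̄/L)` give commuting automorphisms of `L`. -/
lemma isMulCommutative_of_commute {G : Type*} [Group G] (φ : GQ →* G)
    {K L : IntermediateField ℚ QBar} (hKL : K ≤ L) [IsGalois ℚ L] (hL : L.fixingSubgroup = φ.ker)
    (h : ∀ σ ∈ K.fixingSubgroup, ∀ τ ∈ K.fixingSubgroup, Commute (φ σ) (φ τ)) :
    IsMulCommutative Gal(IntermediateField.extendScalars hKL/K) := by
  refine ⟨⟨fun f g => ?_⟩⟩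
  obtain ⟨σ, hσ, hf⟩ := exists_mem_fixingSubgroup_of_algEquiv hKL f
  obtain ⟨τ, hτ, hg⟩ := exists_mem_fixingSubgroup_of_algEquiv hKL g
  ext x
  rw [AlgEquiv.mul_apply, AlgEquiv.mul_apply, ← hf, ← hg, ← hg, ← hf]
  have h1 : (τ * σ)⁻¹ * (σ * τ) ∈ L.fixingSubgroup := by
    rw [hL, MonoidHom.mem_ker, map_mul, map_inv, map_mul, map_mul, (h σ hσ τ hτ).eq,
      inv_mul_cancel]
  have h2 := (IntermediateField.mem_fixingSubgroup_iff _ _).1 h1 x x.2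
  have h3 := congrArg (τ * σ : GQ) h2
  rw [← AlgEquiv.mul_apply, mul_inv_cancel_left] at h3
  exact h3

/-- If `L/K` is abelian and defined over `ℚ`, the group `Gal(ℚ̄/K)` is central modulo
`Gal(ℚ̄/L)`. -/
lemma IsDefinedOverRat.commute {G : Type*} [Group G] (φ : GQ →* G)
    {K L : IntermediateField ℚ QBar} [FiniteDimensional ℚ K] [IsGalois ℚ K]
    (hL : L.fixingSubgroup = φ.ker)
    (h : ∀ σ ∈ K.fixingSubgroup, ∀ τ ∈ K.fixingSubgroup, Commute (φ σ) (φ τ))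
    (hdef : IsDefinedOverRat K L) {τ : GQ} (hτ : τ ∈ K.fixingSubgroup) (σ : GQ) :
    Commute (φ τ) (φ σ) := by
  obtain ⟨E, hE, hsup, hinf⟩ := hdef
  have hEn : E.fixingSubgroup.Normal := (isGalois_iff_normal_fixingSubgroup E).1 hE
  have hKn : K.fixingSubgroup.Normal := (isGalois_iff_normal_fixingSubgroup K).1 inferInstance
  have hσ : σ ∈ K.fixingSubgroup ⊔ E.fixingSubgroup := by
    rw [fixingSubgroup_sup_eq_top hinf]
    exact Subgroup.mem_top σ
  rw [Subgroup.mem_sup_of_normal_right] at hσ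
  obtain ⟨κ, hκ, ε, hε, hκε⟩ := hσ
  rw [← hκε, map_mul]
  refine (h τ hτ κ hκ).mul_right ?_
  -- A commutator of elements of two normal subgroups lies in their intersection, here `G_K ∩ G_E =
  -- G_L`.
  have h1 : τ * ε * τ⁻¹ * ε⁻¹ ∈ L.fixingSubgroup := by
    rw [← hsup, IntermediateField.fixingSubgroup_sup]
    refine Subgroup.mem_inf.2 ⟨?_, mul_mem (hEn.conj_mem ε hε τ) (inv_mem hε)⟩
    rw [mul_assoc, mul_assoc, ← mul_assoc ε]
    exact mul_mem hτ (hKn.conj_mem _ (inv_mem hτ) ε)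
  rw [hL, MonoidHom.mem_ker, map_mul, map_mul, map_mul, map_inv, map_inv,
    mul_inv_eq_one, mul_inv_eq_iff_eq_mul] at h1
  exact h1

/-- Elements of the kernel of a square-zero reduction commute. -/
lemma commute_of_reduceGL_eq_one {k T : Type*} [Field k] [CommRing T] [Algebra k T] {π : T →ₐ[k] k}
    (hπ : ∀ x y, π x = 0 → π y = 0 → x * y = 0) {g h : GL (Fin 2) T} (hg : reduceGL π g = 1)
    (hh : reduceGL π h = 1) : Commute g h := by
  have hg0 := sub_one_apply_mem_ker hg
  have hh0 := sub_one_apply_mem_ker hh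
  have key : ∀ A B : Matrix (Fin 2) (Fin 2) T, (∀ i j, π (A i j) = 0) → (∀ i j, π (B i j) = 0) →
      A * B = 0 := by
    intro A B hA hB
    ext i j
    simp [Matrix.mul_apply, hπ _ _ (hA _ _) (hB _ _)]
  -- Both `(g - 1)(h - 1)` and `(h - 1)(g - 1)` vanish, and equating them gives `gh = hg`.
  have h1 := key _ _ hg0 hh0
  have h2 := key _ _ hh0 hg0
  ext1
  rw [Units.val_mul, Units.val_mul]
  rw [← h2] at h1
  simp only [sub_mul, mul_sub, one_mul, mul_one] at h1
  have h3 := sub_eq_zero.2 h1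
  rw [← sub_eq_zero]
  rw [← h3]
  abel

end GaloisTheory

/-! ### The residue map as a `k`-algebra map. -/

section ResidueField

open IsLocalRing

variable {k 𝕋 : Type*} [Field k] [CommRing 𝕋] [IsLocalRing 𝕋] [Algebra k 𝕋]
  (e : ResidueField 𝕋 ≃ₐ[k] k)

/-- The residue map of `𝕋` as a homomorphism of `k`-algebras onto `k`. -/
def residueAlgHom : 𝕋 →ₐ[k] k :=
  (e : ResidueField 𝕋 →ₐ[k] k).comp (IsScalarTower.toAlgHom k 𝕋 (ResidueField 𝕋))

lemma residueAlgHom_eq_zero_iff (x : 𝕋) : residueAlgHom e x = 0 ↔ x ∈ maximalIdeal 𝕋 := by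
  rw [← residue_eq_zero_iff]
  exact map_eq_zero_iff e e.injective

lemma residualRep_eq {Γ : Type*} [Group Γ] (ρ : Γ →* GL (Fin 2) 𝕋) :
    residualRep e ρ = (reduceGL (residueAlgHom e)).comp ρ := rfl

lemma finrank_ker_residueAlgHom :
    Module.finrank k (LinearMap.ker (residueAlgHom e).toLinearMap) =
      Module.finrank k (maximalIdeal 𝕋) := by
  have : LinearMap.ker (residueAlgHom e).toLinearMap = (maximalIdeal 𝕋).restrictScalars k := by
    ext x
    exact residueAlgHom_eq_zero_iff e x
  rw [this]
  rfl

end ResidueField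

end

/-! ### The arithmetic statement, from full image and Galois theory. -/

theorem proposition5p1
    {k : Type*} [Field k] [Finite k] (p d : ℕ) [Fact p.Prime] [CharP k p]
    (hq : Nat.card k = p ^ d) (hp2 : p ≠ 2) (hq3 : Nat.card k ≠ 3) (hq5 : Nat.card k ≠ 5)
    {𝕋 : Type*} [CommRing 𝕋] [IsLocalRing 𝕋] [Algebra k 𝕋] [Module.Finite k 𝕋]
    [TopologicalSpace 𝕋] [DiscreteTopology 𝕋]
    (e : IsLocalRing.ResidueField 𝕋 ≃ₐ[k] k)
    (h𝔪 : IsLocalRing.maximalIdeal 𝕋 ^ 2 = ⊥)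
    (m : ℕ) (hm : Module.finrank k (IsLocalRing.maximalIdeal 𝕋) = m)
    (ρ : GQ →* GL (Fin 2) 𝕋) (hρ : Continuous ρ)
    (D : Subgroup kˣ)
    (hD : D = (Matrix.GeneralLinearGroup.det.comp (residualRep e ρ)).range)
    (ha : (residualRep e ρ).range = GL2D D k)
    (hb : ρ.range ≤ GL2D D 𝕋)
    (hc : Algebra.adjoin k
      (Set.range fun σ : GQ => Matrix.trace (ρ σ : Matrix (Fin 2) (Fin 2) 𝕋)) = ⊤)
    (N : ℕ) (hN : ∀ ℓ : ℕ, ℓ.Prime → ¬ ℓ ∣ p * N → IsUnramifiedRepAt ρ ℓ) :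
    ∃ (K L : IntermediateField ℚ QBar) (hKL : K ≤ L)
      (_ : NumberField K) (_ : NumberField L) (_ : IsGalois ℚ K) (_ : IsGalois ℚ L),
      -- `G_K = ker ρ̄` and `G_L = ker ρ`
      K.fixingSubgroup = (residualRep e ρ).ker ∧ L.fixingSubgroup = ρ.ker ∧
      -- `Gal(K/ℚ) = GL₂^D(k)`, the identification being the one induced by `ρ̄`
      (∃ eK : Gal(K/ℚ) ≃* GL2D D k,
        (∀ σ : GQ,
          (eK (AlgEquiv.restrictNormalHom K σ) : GL (Fin 2) k) = residualRep e ρ σ) ∧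
        -- `Gal(L/ℚ) = M₂⁰(k)^m ⋊ Gal(K/ℚ)`, compatibly with the restriction map to `Gal(K/ℚ)`.
        -- So `M₂⁰(k)^m` corresponds to `Gal(L/K)`, and the conjugation action of `Gal(K/ℚ)` on
        -- `Gal(L/K)` is the conjugation of matrices.
        ∃ eL : Gal(L/ℚ) ≃* Multiplicative (Fin m → traceZero k)
            ⋊[(conjAction k m).comp ((GL2D D k).subtype.comp eK.toMonoidHom)] Gal(K/ℚ),
          ∀ σ : GQ, (eL (AlgEquiv.restrictNormalHom L σ)).right
            = AlgEquiv.restrictNormalHom K σ) ∧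
      IsAbelianGalois K (IntermediateField.extendScalars hKL) ∧
      Module.finrank K (IntermediateField.extendScalars hKL) = p ^ (3 * d * m) ∧
      (0 < m → ¬ IsDefinedOverRat K L) ∧
      (∀ ℓ : ℕ, ℓ.Prime → ¬ ℓ ∣ p * N →
        IsUnramifiedExtAt K (IntermediateField.extendScalars hKL) ℓ) := by
  obtain ⟨π, hπdef⟩ : ∃ π, π = residueAlgHom e := ⟨_, rfl⟩
  have hres : residualRep e ρ = (reduceGL π).comp ρ := by rw [hπdef, residualRep_eq]
  rw [hres] at ha
  have hπ : ∀ x y, π x = 0 → π y = 0 → x * y = 0 := by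
    intro x y hx hy
    rw [hπdef, residueAlgHom_eq_zero_iff] at hx hy
    have := Ideal.mul_mem_mul hx hy
    rwa [← pow_two, h𝔪, Ideal.mem_bot] at this
  have h2 : (2 : k) ≠ 0 := by
    intro h
    have h3 := (CharP.cast_eq_zero_iff k p 2).1 (by exact_mod_cast h)
    exact hp2 ((Nat.prime_dvd_prime_iff_eq Fact.out Nat.prime_two).1 h3)
  have hmap : ρ.range.map (reduceGL π) = GL2D D k := by
    rw [← ha, MonoidHom.range_comp]
  have hrange : ρ.range = GL2D D 𝕋 := by
    refine eq_GL2D_of_adjoin_trace h2 hq3 hq5 hπ hb hmap ?_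
    rw [← hc]
    congr 1
    ext t
    simp
  obtain ⟨ψ, hψ, hinj, hsurj⟩ := exists_derivations (m := m) (π := π)
    (by rw [hπdef, finrank_ker_residueAlgHom, hm])
  have hopenL : IsOpen (ρ.ker : Set GQ) := (isOpen_discrete ({1} : Set (GL (Fin 2) 𝕋))).preimage hρ
  have hle : ρ.ker ≤ (residualRep e ρ).ker := fun σ hσ => by
    rw [hres, MonoidHom.mem_ker, MonoidHom.comp_apply, MonoidHom.mem_ker.1 hσ, map_one]
  have hopenK : IsOpen ((residualRep e ρ).ker : Set GQ) := Subgroup.isOpen_mono hle hopenL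
  obtain ⟨hKfix, hKfin, hKgal⟩ := fixedField_ker _ hopenK
  obtain ⟨hLfix, hLfin, hLgal⟩ := fixedField_ker _ hopenL
  have hKL : IntermediateField.fixedField (residualRep e ρ).ker ≤
      IntermediateField.fixedField ρ.ker := IntermediateField.fixedField_antitone hle
  generalize IntermediateField.fixedField (residualRep e ρ).ker = K at *
  generalize IntermediateField.fixedField ρ.ker = L at *
  have hcomm : ∀ σ ∈ K.fixingSubgroup, ∀ τ ∈ K.fixingSubgroup, Commute (ρ σ) (ρ τ) := by
    intro σ hσ τ hτ
    rw [hKfix, hres] at hσ hτ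
    exact commute_of_reduceGL_eq_one hπ hσ hτ
  have hNK : NumberField K := { to_charZero := inferInstance, to_finiteDimensional := hKfin }
  have hNL : NumberField L := { to_charZero := inferInstance, to_finiteDimensional := hLfin }
  have hMgal : IsGalois ℚ (IntermediateField.extendScalars hKL) := hLgal
  have hNM : NumberField (IntermediateField.extendScalars hKL) := hNL
  have hsurjK : Function.Surjective (AlgEquiv.restrictNormalHom K : GQ →* Gal(K/ℚ)) :=
    AlgEquiv.restrictNormalHom_surjective QBar
  have hsurjL : Function.Surjective (AlgEquiv.restrictNormalHom L : GQ →* Gal(L/ℚ)) :=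
    AlgEquiv.restrictNormalHom_surjective QBar
  obtain ⟨eK, heK⟩ : ∃ eK : Gal(K/ℚ) ≃* GL2D D k, ∀ σ : GQ,
      (eK (AlgEquiv.restrictNormalHom K σ) : GL (Fin 2) k) = reduceGL π (ρ σ) := by
    have hmem : ∀ σ, (reduceGL π).comp ρ σ ∈ GL2D D k := fun σ => ha ▸ ⟨σ, rfl⟩
    obtain ⟨eK, heK⟩ := exists_mulEquiv_of_ker_eq (AlgEquiv.restrictNormalHom K : GQ →* Gal(K/ℚ))
      (((reduceGL π).comp ρ).codRestrict (GL2D D k) hmem) hsurjK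
      (by
        rintro ⟨g, hg⟩
        rw [← ha] at hg
        obtain ⟨σ, hσ⟩ := hg
        exact ⟨σ, Subtype.ext hσ⟩)
      (by
        rw [MonoidHom.ker_codRestrict, ker_restrictNormalHom, hKfix, hres])
    exact ⟨eK, fun σ => congrArg Subtype.val (heK σ)⟩
  obtain ⟨eL, heL⟩ := exists_mulEquiv_of_ker_eq (AlgEquiv.restrictNormalHom L : GQ →* Gal(L/ℚ))
    (toSemidirect hπ ψ hψ ρ hrange.le (AlgEquiv.restrictNormalHom K) eK heK) hsurjL
    (toSemidirect_surjective hrange hsurj)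
    (by rw [ker_restrictNormalHom, hLfix, ker_toSemidirect _ hinj])
  refine ⟨K, L, hKL, hNK, hNL, hKgal, hLgal, hKfix, hLfix, ⟨eK, fun σ => ?_, eL, fun σ => ?_⟩,
    ?_, ?_, ?_, ?_⟩
  · rw [heK, hres]
    rfl
  · rw [heL, toSemidirect_right]
  · exact { toIsGalois := IsGalois.tower_top_of_isGalois ℚ K _
            toIsMulCommutative := isMulCommutative_of_commute ρ hKL hLfix hcomm }
  · have h1 : Nat.card Gal(L/ℚ) = Nat.card k ^ (3 * m) * Nat.card Gal(K/ℚ) := by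
      rw [Nat.card_congr eL.toEquiv, SemidirectProduct.card,
        Nat.card_congr (Multiplicative.toAdd (α := Fin m → traceZero k)), Nat.card_fun,
        card_traceZero, Nat.card_eq_fintype_card (α := Fin m), Fintype.card_fin, ← pow_mul]
    rw [IsGalois.card_aut_eq_finrank, IsGalois.card_aut_eq_finrank] at h1
    have h3 : Module.finrank ℚ (IntermediateField.extendScalars hKL) = Module.finrank ℚ L := rfl
    rw [← h3, ← Module.finrank_mul_finrank ℚ K (IntermediateField.extendScalars hKL), mul_comm,
      hq, ← pow_mul] at h1
    rw [Nat.eq_of_mul_eq_mul_right Module.finrank_pos h1]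
    ring_nf
  · intro hm0 hdef
    obtain ⟨v, hv, hv0⟩ : ∃ v, π v = 0 ∧ v ≠ 0 := by
      obtain ⟨v, hv, hv1⟩ := hsurj fun _ => 1
      refine ⟨v, hv, fun h => ?_⟩
      have := hv1 ⟨0, hm0⟩
      rw [h, map_zero] at this
      exact zero_ne_one this
    -- The upper left entries of `u(v) l(1)` and `l(1) u(v)` are `1 + v` and `1`, so commuting would
    -- force `v = 0`.
    obtain ⟨τ, hτ⟩ : upperUnip v ∈ ρ.range :=
      hrange ▸ mem_GL2D_of_det_eq_one D (by simp [Matrix.det_fin_two])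
    obtain ⟨σ, hσ⟩ : lowerUnip 1 ∈ ρ.range :=
      hrange ▸ mem_GL2D_of_det_eq_one D (by simp [Matrix.det_fin_two])
    have hτK : τ ∈ K.fixingSubgroup := by
      rw [hKfix, hres, MonoidHom.mem_ker, MonoidHom.comp_apply, hτ]
      ext i j
      rw [coe_reduceGL, coe_upperUnip]
      fin_cases i <;> fin_cases j <;> simp [hv]
    have h1 := hdef.commute ρ hLfix hcomm hτK σ
    rw [hτ, hσ] at h1
    have h3 := congrArg (fun g : GL (Fin 2) 𝕋 => (g : Matrix (Fin 2) (Fin 2) 𝕋) 0 0) h1.eq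
    simp only [Units.val_mul, coe_upperUnip, coe_lowerUnip] at h3
    simp at h3
    exact hv0 h3
  · intro ℓ hℓ hℓN P _ hP
    -- The hypothesis on `ρ` even makes `L/ℚ` unramified at `ℓ`; unramifiedness over `𝓞 K` follows.
    have : Algebra.IsUnramifiedAt ℤ P := by
      refine isUnramifiedAt_int_of_inertia_le (IntermediateField.extendScalars hKL)
        (fun 𝔩 h𝔩 hℓ𝔩 σ hσ => ?_) P hP
      have h1 : σ ∈ L.fixingSubgroup := hLfix ▸ hN ℓ hℓ hℓN 𝔩 h𝔩 hℓ𝔩 hσ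
      rw [MonoidHom.mem_ker]
      ext x
      exact (AlgEquiv.restrictNormal_commutes σ (IntermediateField.extendScalars hKL) x).trans
        ((IntermediateField.mem_fixingSubgroup_iff _ _).1 h1 x x.2)
    exact Algebra.IsUnramifiedAt.of_restrictScalars ℤ P
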